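/- For $a\in\mathbb{R}^2$ write $x^a:=x_1^{a_1}x_2^{a_2}$. A bivariate trinomial is a function $f=\sum_{a\in A}c_ax^a$ on the positive quadrant $\mathbb{R}^2_+=\{x\in\mathbb{R}^2 : x_1,x_2>0\}$, where $A=\mathrm{Supp}(f)\subset\mathbb{R}^2$ consists of exactly three (real) exponent vectors and every $c_a$ is a nonzero real number; its Newton polygon $\mathrm{Newt}(f)$ is the convex hull of $\mathrm{Supp}(f)$ (possibly a segment). For a pair $F=(f_1,f_2)$ of bivariate trinomials let $P_F:=\mathrm{Newt}(f_1)+\mathrm{Newt}(f_2)$ be the Minkowski sum. A common root $\zeta\in\mathbb{R}^2_+$ of $f_1,f_2$ is called isolated if the only arc contained in the set of common roots in $\mathbb{R}^2_+$ and containing $\zeta$ is $\{\zeta\}$; here an arc is a point or a homeomorphic image of the unit circle or of the open, closed or half-open unit interval. Then the maximal number of isolated roots in $\mathbb{R}^2_+$, over all pairs $F$ of bivariate trinomials with $P_F$ as indicated, is - $0$ if $P_F$ is a line segment; - $2$ if $P_F$ is a triangle; - $4$ if $P_F$ is a quadrilateral; - $4$ if $P_F$ is a pentagon. In each of the four cases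 the stated number is an upper bound for every such $F$ and is attained by some such $F$. Consequently, if a pair $F$ of bivariate trinomials has at least $5$ isolated roots in $\mathbb{R}^2_+$, then $P_F$ is a hexagon. -/

import Mathlib

open scoped Pointwise

noncomputable section

/-- The ring `ℝ[x^a | a ∈ ℝⁿ]` of real polynomials in `n` variables with real exponent vectors. -/
abbrev Fewnomial (n : ℕ) : Type := AddMonoidAlgebra ℝ (Fin n → ℝ)

namespace Fewnomial

/-- The support of `f = ∑ c_a x^a`: the set of `a` with `c_a ≠ 0`. -/
def supp {n : ℕ} (f : Fewnomial n) : Finset (Fin n → ℝ) := f.coeff.support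

/-- The value `∑ c_a x₁^{a₁} ⋯ xₙ^{aₙ}` (used only at points of the positive orthant). -/
def value {n : ℕ} (f : Fewnomial n) (x : Fin n → ℝ) : ℝ :=
  ∑ a ∈ f.supp, f.coeff a * ∏ i, x i ^ a i

/-- The Newton polytope: the convex hull of the support. -/
def newt {n : ℕ} (f : Fewnomial n) : Set (Fin n → ℝ) :=
  convexHull ℝ (f.supp : Set (Fin n → ℝ))

end Fewnomial

/-- A `k × n` system of fewnomials. -/
abbrev FewnomialSystem (k n : ℕ) : Type := Fin k → Fewnomial n

namespace FewnomialSystem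

/-- `F` is of type `(m₁, …, m_k)`: its `i`-th member has exactly `m_i` monomial terms. -/
def IsOfType {k n : ℕ} (F : FewnomialSystem k n) (m : Fin k → ℕ) : Prop :=
  ∀ i, (F i).supp.card = m i

/-- The set of common roots in the positive orthant. -/
def positiveRoots {k n : ℕ} (F : FewnomialSystem k n) : Set (Fin n → ℝ) :=
  {x | (∀ j, 0 < x j) ∧ ∀ i, (F i).value x = 0}

/-- The Minkowski sum of the Newton polytopes. -/
def newtSum {k n : ℕ} (F : FewnomialSystem k n) : Set (Fin n → ℝ) :=
  ∑ i, (F i).newt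

end FewnomialSystem

/-- An arc: a point, or a homeomorphic image of the unit circle or of the
open, closed or half-open unit interval. -/
def IsArc {X : Type*} [TopologicalSpace X] (A : Set X) : Prop :=
  (∃ p, A = {p}) ∨ Nonempty (Circle ≃ₜ A) ∨ Nonempty (Set.Ioo (0 : ℝ) 1 ≃ₜ A) ∨
    Nonempty (Set.Icc (0 : ℝ) 1 ≃ₜ A) ∨ Nonempty (Set.Ico (0 : ℝ) 1 ≃ₜ A) ∨
    Nonempty (Set.Ioc (0 : ℝ) 1 ≃ₜ A)

/-- The isolated positive roots of `F`: the positive roots `z` such that the only arc of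
positive roots containing `z` is `{z}`. -/
def FewnomialSystem.isolatedRoots {k n : ℕ} (F : FewnomialSystem k n) : Set (Fin n → ℝ) :=
  {z | z ∈ F.positiveRoots ∧ ∀ A : Set (Fin n → ℝ), IsArc A → A ⊆ F.positiveRoots → z ∈ A → A = {z}}

/-- A nondegenerate line segment. -/
def IsLineSegment {n : ℕ} (P : Set (Fin n → ℝ)) : Prop :=
  ∃ p q, p ≠ q ∧ P = segment ℝ p q

/-- A (convex) `l`-gon, `l ≥ 3`: the convex hull of `l` points of the plane in convex position. -/
def IsPolygon (l : ℕ) (P : Set (Fin 2 → ℝ)) : Prop :=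
  3 ≤ l ∧ ∃ v : Fin l → (Fin 2 → ℝ), ConvexIndependent ℝ v ∧ P = convexHull ℝ (Set.range v)

/-- `N` is the maximal number of isolated positive roots among the `2 × 2` systems of type `(3,3)`
(pairs of bivariate trinomials) whose Minkowski sum of Newton polygons satisfies `C`; that is,
`N` bounds the number of isolated positive roots of each such system and is attained. -/
def IsMaxIsolatedRootsOfTrinomialPairs (C : Set (Fin 2 → ℝ) → Prop) (N : ℕ∞) : Prop :=
  IsGreatest {r : ℕ∞ | ∃ F : FewnomialSystem 2 2,
    F.IsOfType ![3, 3] ∧ C F.newtSum ∧ F.isolatedRoots.encard = r} N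

end

/-!
Monomials with real exponents satisfy multiplicative relations as soon as the exponents satisfy
linear ones (`mon_eq_of_sub_eq`), so a linear change of exponents is a change of coordinates of
the positive quadrant. If the exponents of the first trinomial are affinely independent, its zero
set becomes the part of an affine line `s = p + q t` in the quadrant `t, s > 0`, and the isolated
common roots are counted by the zeros of a function
`d₀ + d₁ t ^ i₁ (p + q t) ^ j₁ + d₂ t ^ i₂ (p + q t) ^ j₂` of one variable; when this function
vanishes identically, the roots fill an arc and none is isolated
(`encard_isolatedPoints_rootSet_le`). Such functions are handled by repeated use of Rolle's
theorem (`ZerosLE.of_hasDerivAt`):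

* if an edge of the second Newton polygon is parallel to an edge of the first, two derivatives
  reduce the function to a quadratic polynomial, so there are at most four zeros
  (`zerosLE_four_of_parallel`);
* if the Newton polygons are homothetic, there are at most two (`zerosLE_two_of_homothetic`);
* if the second Newton polygon is a segment, there are at most four
  (`zerosLE_four_of_collinear`).

If both Newton polygons are segments, the system consists of two univariate trinomials, each with
at most two positive roots. These are in independent monomials, or else all exponents lie in one
direction and the root set is invariant under a one-parameter group
(`isolatedPoints_eq_empty_of_parallel`).

Hence more than four isolated roots force both Newton polygons to be triangles without parallel
edges, and the Minkowski sum of two such triangles is a hexagon (`isPolygon_six`): whether a sum of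
two vertices is extreme depends only on the signs of the determinants of pairs of edges, and for
every sign pattern compatible with the Plücker relation exactly six of the nine sums are
extreme (`card_vertexPattern`). Since the number of vertices of a polygon is well defined
(`IsPolygon.ncard_extremePoints`), this gives the bound for quadrilaterals and pentagons. If the
Minkowski sum is a triangle, the summands are homothetic to it
(`exists_homothety_of_convexHull_eq`). The bounds are attained by explicit pairs.
-/

noncomputable section

/-! ### Zero counts on an interval -/

/-- On `I` the function `f` either vanishes identically or has at most `n` zeros. -/
def ZerosLE (n : ℕ) (f : ℝ → ℝ) (I : Set ℝ) : Prop :=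
  (∀ t ∈ I, f t = 0) ∨ {t ∈ I | f t = 0}.encard ≤ n

theorem ZerosLE.const (r : ℝ) (I : Set ℝ) : ZerosLE 0 (fun _ => r) I := by
  by_cases hr : r = 0
  · exact Or.inl fun _ _ => hr
  · right
    simp [hr]

theorem ZerosLE.mul {n m : ℕ} {f g : ℝ → ℝ} {I : Set ℝ} (hf : ZerosLE n f I)
    (hg : ZerosLE m g I) : ZerosLE (n + m) (fun t => f t * g t) I := by
  rcases hf with hf | hf
  · exact Or.inl fun t ht => by simp [hf t ht]
  rcases hg with hg | hg
  · exact Or.inl fun t ht => by simp [hg t ht]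
  right
  have : {t ∈ I | f t * g t = 0} = {t ∈ I | f t = 0} ∪ {t ∈ I | g t = 0} := by
    ext t
    simp only [mul_eq_zero, Set.mem_ofPred_eq, Set.mem_union]
    tauto
  rw [this]
  refine (Set.encard_union_le _ _).trans ?_
  push_cast
  exact add_le_add hf hg

theorem ZerosLE.of_iff {n : ℕ} {f g : ℝ → ℝ} {I : Set ℝ} (hf : ZerosLE n f I)
    (h : ∀ t ∈ I, (g t = 0 ↔ f t = 0)) : ZerosLE n g I := by
  rcases hf with hf | hf
  · exact Or.inl fun t ht => (h t ht).2 (hf t ht)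
  · right
    have : {t ∈ I | g t = 0} = {t ∈ I | f t = 0} := by
      ext t
      simp only [Set.mem_ofPred_eq]
      exact and_congr_right (h t)
    rwa [this]

/-- Only the zeros matter, so a nonvanishing factor may be dropped. -/
theorem ZerosLE.of_eq_mul {n : ℕ} {f g u : ℝ → ℝ} {I : Set ℝ} (hf : ZerosLE n f I)
    (hu : ∀ t ∈ I, u t ≠ 0) (h : ∀ t ∈ I, g t = u t * f t) : ZerosLE n g I :=
  hf.of_iff fun t ht => by simp [h t ht, hu t ht]

/-- Rolle's theorem as a bound on numbers of zeros. -/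
theorem ZerosLE.of_hasDerivAt {n : ℕ} {f f' : ℝ → ℝ} {I : Set ℝ} (hI : I.OrdConnected)
    (hf : ∀ t ∈ I, HasDerivAt f (f' t) t) (h : ZerosLE n f' I) : ZerosLE (n + 1) f I := by
  rcases h with h | h
  · by_cases h0 : ∃ t ∈ I, f t = 0
    · obtain ⟨t, ht, hft⟩ := h0
      refine Or.inl fun s hs => ?_
      rw [← hft]
      refine hI.convex.is_const_of_fderivWithin_eq_zero (𝕜 := ℝ)
        (fun x hx => (hf x hx).differentiableAt.differentiableWithinAt) (fun x hx => ?_) hs ht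
      have h1 : HasFDerivWithinAt f (0 : ℝ →L[ℝ] ℝ) I x := by
        have := (hf x hx).hasFDerivAt.hasFDerivWithinAt (s := I)
        rw [h x hx] at this
        simpa using this
      by_cases hu : UniqueDiffWithinAt ℝ I x
      · exact h1.fderivWithin hu
      · exact fderivWithin_zero_of_not_uniqueDiffWithinAt hu
    · right
      have : {t ∈ I | f t = 0} = ∅ := by
        ext t
        simp only [Set.mem_ofPred_eq, Set.mem_empty_iff_false, iff_false]
        exact fun ht => h0 ⟨t, ht⟩
      simp [this]
  · right
    have hfin : {t ∈ I | f' t = 0}.Finite := Set.finite_of_encard_le_coe h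
    have hcard : hfin.toFinset.card ≤ n := by
      rw [hfin.encard_eq_coe_toFinset_card] at h
      exact_mod_cast h
    have key : ∀ s : Finset ℝ, (s : Set ℝ) ⊆ {t ∈ I | f t = 0} → s.card ≤ n + 1 := by
      intro s hs
      refine (Finset.card_le_of_interleaved (t := hfin.toFinset) ?_).trans (by omega)
      intro x hx y hy hxy _
      have hx' := hs hx
      have hy' := hs hy
      have hsub : Set.Icc x y ⊆ I := hI.out hx'.1 hy'.1
      obtain ⟨z, hz, hz0⟩ := exists_hasDerivAt_eq_zero hxy
        (fun t ht => (hf t (hsub ht)).continuousAt.continuousWithinAt)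
        (hx'.2.trans hy'.2.symm) (fun t ht => hf t (hsub (Set.Ioo_subset_Icc_self ht)))
      exact ⟨z, by simpa using ⟨hsub (Set.Ioo_subset_Icc_self hz), hz0⟩, hz.1, hz.2⟩
    by_contra hcon
    push Not at hcon
    obtain ⟨s, hs, hs'⟩ := Set.exists_subset_encard_eq (Order.add_one_le_of_lt hcon)
    have hsf : s.Finite := Set.finite_of_encard_eq_coe (k := n + 1 + 1) (by exact_mod_cast hs')
    have h2 := key hsf.toFinset (by simpa using hs)
    rw [hsf.encard_eq_coe_toFinset_card] at hs'
    have h3 : hsf.toFinset.card = n + 1 + 1 := by exact_mod_cast hs'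
    omega

theorem ZerosLE.affine (a b : ℝ) {I : Set ℝ} (hI : I.OrdConnected) :
    ZerosLE 1 (fun t => a * t + b) I :=
  (ZerosLE.const a I).of_hasDerivAt hI fun t _ => by
    simpa using ((hasDerivAt_id t).const_mul a).add_const b

theorem ZerosLE.quadratic (a b c : ℝ) {I : Set ℝ} (hI : I.OrdConnected) :
    ZerosLE 2 (fun t => a * t ^ 2 + b * t + c) I :=
  (ZerosLE.affine (2 * a) b hI).of_hasDerivAt hI fun t _ => by
    have h := ((hasDerivAt_pow 2 t).const_mul a).add (((hasDerivAt_id t).const_mul b))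
    exact (h.add_const c).congr_deriv (by simp; ring)

/-! ### Trinomials restricted to a trinomial curve -/

/-- The set of `t > 0` at which the affine function `p + q t` is positive. -/
def posInterval (p q : ℝ) : Set ℝ := {t | 0 < t ∧ 0 < p + q * t}

theorem ordConnected_posInterval (p q : ℝ) : (posInterval p q).OrdConnected := by
  constructor
  rintro x ⟨hx, hx'⟩ y ⟨hy, hy'⟩ z ⟨hz, hz'⟩
  refine ⟨by linarith, ?_⟩
  rcases le_total 0 q with h | h <;> nlinarith

theorem isOpen_posInterval (p q : ℝ) : IsOpen (posInterval p q) :=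
  (isOpen_lt continuous_const continuous_id).inter
    (isOpen_lt continuous_const (by fun_prop : Continuous fun t : ℝ => p + q * t))

/-- The function `t ^ i (p + q t) ^ j`: a monomial restricted to the line `s = p + q t`. -/
def linMonomial (p q i j t : ℝ) : ℝ := t ^ i * (p + q * t) ^ j

theorem linMonomial_pos {p q t : ℝ} (i j : ℝ) (ht : t ∈ posInterval p q) :
    0 < linMonomial p q i j t :=
  mul_pos (Real.rpow_pos_of_pos ht.1 _) (Real.rpow_pos_of_pos ht.2 _)

theorem linMonomial_mul {p q t : ℝ} (i j i' j' : ℝ) (ht : t ∈ posInterval p q) :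
    linMonomial p q i j t * linMonomial p q i' j' t = linMonomial p q (i + i') (j + j') t := by
  unfold linMonomial
  rw [Real.rpow_add ht.1, Real.rpow_add ht.2]
  ring

theorem linMonomial_one_zero {p q t : ℝ} : linMonomial p q 1 0 t = t := by
  simp [linMonomial]

theorem linMonomial_zero_one {p q t : ℝ} : linMonomial p q 0 1 t = p + q * t := by
  simp [linMonomial]

theorem hasDerivAt_linMonomial {p q t : ℝ} (i j : ℝ) (ht : t ∈ posInterval p q) :
    HasDerivAt (linMonomial p q i j)
      (linMonomial p q (i - 1) (j - 1) t * ((i + j) * q * t + i * p)) t := by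
  have h1 : HasDerivAt (fun t : ℝ => p + q * t) q t := by
    simpa using ((hasDerivAt_id t).const_mul q).const_add p
  have h := ((hasDerivAt_id t).rpow_const (p := i) (Or.inl ht.1.ne')).mul
    (h1.rpow_const (p := j) (Or.inl ht.2.ne'))
  refine h.congr_deriv ?_
  simp only [id, linMonomial]
  have e1 : t ^ i = t ^ (i - 1) * t := by
    rw [← Real.rpow_add_one ht.1.ne']
    simp
  have e2 : (p + q * t) ^ j = (p + q * t) ^ (j - 1) * (p + q * t) := by
    rw [← Real.rpow_add_one ht.2.ne']
    simp
  rw [e1, e2]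
  ring

/-- Along a trinomial curve, a trinomial with one edge parallel to an edge of the curve has at
most four zeros: two Rolle steps lead to a quadratic polynomial. -/
theorem zerosLE_four_of_parallel (p q d₀ d₁ d₂ k i j : ℝ) :
    ZerosLE 4 (fun t => d₀ + d₁ * linMonomial p q k 0 t + d₂ * linMonomial p q i j t)
      (posInterval p q) := by
  have hI := ordConnected_posInterval p q
  -- the second derivative, up to a nonvanishing factor
  have h2 : ZerosLE 2 (fun t => d₂ * (((i - k + (j - 1)) * q * t + (i - k) * p) *
      ((i + j) * q * t + i * p) + t * (p + q * t) * ((i + j) * q))) (posInterval p q) :=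
    (ZerosLE.quadratic (d₂ * ((i - k + (j - 1)) * q * ((i + j) * q) + q * ((i + j) * q)))
      (d₂ * ((i - k + (j - 1)) * q * (i * p) + (i - k) * p * ((i + j) * q) + p * ((i + j) * q)))
      (d₂ * ((i - k) * p * (i * p))) hI).of_iff fun t _ => by
        rw [iff_iff_eq]
        congr 1
        ring
  have h3 : ZerosLE 3 (fun t => d₁ * k + d₂ * (linMonomial p q (i - k) (j - 1) t *
      ((i + j) * q * t + i * p))) (posInterval p q) := by
    refine ZerosLE.of_hasDerivAt hI (f' := fun t => d₂ * (linMonomial p q (i - k - 1) (j - 1 - 1) t *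
      ((i - k + (j - 1)) * q * t + (i - k) * p) * ((i + j) * q * t + i * p) +
      linMonomial p q (i - k) (j - 1) t * ((i + j) * q))) (fun t ht => ?_) ?_
    · have h := (hasDerivAt_linMonomial (i - k) (j - 1) ht).mul
        (((hasDerivAt_id t).const_mul ((i + j) * q)).add_const (i * p))
      simpa using (h.const_mul d₂).const_add (d₁ * k)
    · refine h2.of_eq_mul (u := linMonomial p q (i - k - 1) (j - 1 - 1))
        (fun t ht => (linMonomial_pos _ _ ht).ne') (fun t ht => ?_)
      have e : linMonomial p q (i - k) (j - 1) t =
          linMonomial p q (i - k - 1) (j - 1 - 1) t * (t * (p + q * t)) := by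
        have e' : t * (p + q * t) = linMonomial p q 1 1 t := by simp [linMonomial]
        rw [e', linMonomial_mul _ _ _ _ ht]
        congr 1 <;> ring
      rw [e]
      ring
  refine ZerosLE.of_hasDerivAt hI (f' := fun t => d₁ * (linMonomial p q (k - 1) (0 - 1) t *
      ((k + 0) * q * t + k * p)) + d₂ * (linMonomial p q (i - 1) (j - 1) t *
      ((i + j) * q * t + i * p))) (fun t ht => ?_) ?_
  · exact (((hasDerivAt_linMonomial k 0 ht).const_mul d₁).const_add d₀).add
      ((hasDerivAt_linMonomial i j ht).const_mul d₂)
  · refine h3.of_eq_mul (u := linMonomial p q (k - 1) 0)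
      (fun t ht => (linMonomial_pos _ _ ht).ne') (fun t ht => ?_)
    have e1 : linMonomial p q (k - 1) 0 t = linMonomial p q (k - 1) (0 - 1) t * (p + q * t) := by
      rw [← linMonomial_zero_one (p := p) (q := q) (t := t), linMonomial_mul _ _ _ _ ht]
      congr 1 <;> ring
    have e2 : linMonomial p q (i - 1) (j - 1) t =
        linMonomial p q (k - 1) 0 t * linMonomial p q (i - k) (j - 1) t := by
      rw [linMonomial_mul _ _ _ _ ht]
      congr 1 <;> ring
    rw [e2, e1]
    ring

/-- Along a trinomial curve, a trinomial with homothetic Newton polygon has at most two zeros. -/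
theorem zerosLE_two_of_homothetic (p q d₀ d₁ d₂ k : ℝ) :
    ZerosLE 2 (fun t => d₀ + d₁ * linMonomial p q k 0 t + d₂ * linMonomial p q 0 k t)
      (posInterval p q) := by
  have hI := ordConnected_posInterval p q
  have h1 : ZerosLE 1 (fun t => d₂ * k * q + d₁ * k * linMonomial p q (k - 1) (1 - k) t)
      (posInterval p q) := by
    refine ZerosLE.of_hasDerivAt hI (f' := fun t => d₁ * k * (linMonomial p q (k - 1 - 1)
      (1 - k - 1) t * ((k - 1 + (1 - k)) * q * t + (k - 1) * p))) (fun t ht => ?_) ?_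
    · exact ((hasDerivAt_linMonomial _ _ ht).const_mul (d₁ * k)).const_add (d₂ * k * q)
    · refine (ZerosLE.const (d₁ * k * ((k - 1) * p)) _).of_eq_mul
        (u := linMonomial p q (k - 1 - 1) (1 - k - 1))
        (fun t ht => (linMonomial_pos _ _ ht).ne') (fun t ht => ?_)
      ring
  refine ZerosLE.of_hasDerivAt hI (f' := fun t => d₁ * (linMonomial p q (k - 1) (0 - 1) t *
      ((k + 0) * q * t + k * p)) + d₂ * (linMonomial p q (0 - 1) (k - 1) t *
      ((0 + k) * q * t + 0 * p))) (fun t ht => ?_) ?_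
  · exact (((hasDerivAt_linMonomial k 0 ht).const_mul d₁).const_add d₀).add
      ((hasDerivAt_linMonomial 0 k ht).const_mul d₂)
  · refine h1.of_eq_mul (u := linMonomial p q 0 (k - 1))
      (fun t ht => (linMonomial_pos _ _ ht).ne') (fun t ht => ?_)
    have e1 : linMonomial p q (k - 1) (0 - 1) t * (p + q * t) = linMonomial p q (k - 1) 0 t := by
      rw [← linMonomial_zero_one (p := p) (q := q) (t := t), linMonomial_mul _ _ _ _ ht]
      congr 1 <;> ring
    have e2 : linMonomial p q (0 - 1) (k - 1) t * t = linMonomial p q 0 (k - 1) t := by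
      nth_rw 2 [← linMonomial_one_zero (p := p) (q := q) (t := t)]
      rw [linMonomial_mul _ _ _ _ ht]
      congr 1 <;> ring
    have e3 : linMonomial p q 0 (k - 1) t * linMonomial p q (k - 1) (1 - k) t =
        linMonomial p q (k - 1) 0 t := by
      rw [linMonomial_mul _ _ _ _ ht]
      congr 1 <;> ring
    linear_combination d₁ * k * e1 + d₂ * k * q * e2 - d₁ * k * e3

/-- Along a trinomial curve, a trinomial with collinear exponents has at most four zeros: its
derivative is the product of two functions with at most one and two zeros. -/
theorem zerosLE_four_of_collinear (p q d₀ d₁ d₂ i j k : ℝ) :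
    ZerosLE 4 (fun t => d₀ + d₁ * linMonomial p q i j t + d₂ * linMonomial p q (k * i) (k * j) t)
      (posInterval p q) := by
  have hI := ordConnected_posInterval p q
  have h1 := ZerosLE.affine ((i + j) * q) (i * p) hI
  have h2 : ZerosLE 2 (fun t => d₁ + d₂ * k * linMonomial p q ((k - 1) * i) ((k - 1) * j) t)
      (posInterval p q) := by
    refine ZerosLE.of_hasDerivAt hI (f' := fun t => d₂ * k * (linMonomial p q ((k - 1) * i - 1)
      ((k - 1) * j - 1) t * (((k - 1) * i + (k - 1) * j) * q * t + (k - 1) * i * p)))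
      (fun t ht => ?_) ?_
    · exact ((hasDerivAt_linMonomial _ _ ht).const_mul (d₂ * k)).const_add d₁
    · refine ((ZerosLE.const (d₂ * k * (k - 1)) _).mul h1).of_eq_mul
        (u := linMonomial p q ((k - 1) * i - 1) ((k - 1) * j - 1))
        (fun t ht => (linMonomial_pos _ _ ht).ne') (fun t ht => ?_)
      ring
  refine ZerosLE.of_hasDerivAt hI (f' := fun t => d₁ * (linMonomial p q (i - 1) (j - 1) t *
      ((i + j) * q * t + i * p)) + d₂ * (linMonomial p q (k * i - 1) (k * j - 1) t *
      ((k * i + k * j) * q * t + k * i * p))) (fun t ht => ?_) ?_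
  · exact (((hasDerivAt_linMonomial i j ht).const_mul d₁).const_add d₀).add
      ((hasDerivAt_linMonomial (k * i) (k * j) ht).const_mul d₂)
  · refine (h1.mul h2).of_eq_mul (u := linMonomial p q (i - 1) (j - 1))
      (fun t ht => (linMonomial_pos _ _ ht).ne') (fun t ht => ?_)
    have e : linMonomial p q (k * i - 1) (k * j - 1) t =
        linMonomial p q (i - 1) (j - 1) t * linMonomial p q ((k - 1) * i) ((k - 1) * j) t := by
      rw [linMonomial_mul _ _ _ _ ht]
      congr 1 <;> ring
    rw [e]
    ring

/-- A univariate trinomial with distinct real exponents `0`, `1`, `k` has at most two positive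
zeros. -/
theorem encard_zeros_trinomial_le (d₀ d₁ : ℝ) {d₂ k : ℝ} (hd : d₂ ≠ 0) (hk₀ : k ≠ 0)
    (hk₁ : k ≠ 1) : {t : ℝ | 0 < t ∧ d₀ + d₁ * t + d₂ * t ^ k = 0}.encard ≤ 2 := by
  have hI : (Set.Ioi (0 : ℝ)).OrdConnected := Set.ordConnected_Ioi
  have hz : {t ∈ Set.Ioi (0 : ℝ) | k * (k - 1) * d₂ * t ^ (k - 1 - 1) = 0}.encard ≤ (0 : ℕ) := by
    have : {t ∈ Set.Ioi (0 : ℝ) | k * (k - 1) * d₂ * t ^ (k - 1 - 1) = 0} = ∅ := by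
      ext t
      simp only [Set.mem_ofPred_eq, Set.mem_empty_iff_false, iff_false, not_and]
      intro ht
      exact mul_ne_zero (mul_ne_zero (mul_ne_zero hk₀ (sub_ne_zero.2 hk₁)) hd)
        (Real.rpow_pos_of_pos ht _).ne'
    rw [this, Set.encard_empty]
    exact zero_le
  have h1 : ZerosLE 1 (fun t => d₁ + k * d₂ * t ^ (k - 1)) (Set.Ioi 0) := by
    refine ZerosLE.of_hasDerivAt hI (fun t ht => ?_) (Or.inr hz)
    have h := (((hasDerivAt_id t).rpow_const (p := k - 1) (Or.inl (ne_of_gt ht))).const_mul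
      (k * d₂)).const_add d₁
    exact h.congr_deriv (by simp only [id]; ring)
  have h2 : ZerosLE 2 (fun t => d₀ + d₁ * t + d₂ * t ^ k) (Set.Ioi 0) := by
    refine h1.of_hasDerivAt hI (fun t ht => ?_)
    have h := (((hasDerivAt_id t).const_mul d₁).const_add d₀).add
      (((hasDerivAt_id t).rpow_const (p := k) (Or.inl (ne_of_gt ht))).const_mul d₂)
    exact h.congr_deriv (by simp only [id]; ring)
  rcases h2 with h2 | h2
  · exfalso
    -- if the trinomial vanished identically, so would its derivative, in particular at `1` and `2`
    have hd1 : ∀ t ∈ Set.Ioi (0 : ℝ), d₁ + k * d₂ * t ^ (k - 1) = 0 := by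
      intro t ht
      have h := (((hasDerivAt_id t).const_mul d₁).const_add d₀).add
        (((hasDerivAt_id t).rpow_const (p := k) (Or.inl (ne_of_gt ht))).const_mul d₂)
      have h0 : HasDerivAt (fun t => d₀ + d₁ * t + d₂ * t ^ k) 0 t :=
        (hasDerivAt_const t (0 : ℝ)).congr_of_eventuallyEq
          (Filter.eventually_of_mem (Ioi_mem_nhds ht) h2)
      have := h.unique h0
      simp only [id] at this
      linarith
    have e1 := hd1 1 (by simp)
    have e2 := hd1 2 (by simp)
    rw [Real.one_rpow] at e1
    have e3 : k * d₂ * ((2 : ℝ) ^ (k - 1) - 1) = 0 := by linarith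
    have e4 : (2 : ℝ) ^ (k - 1) = 1 := by
      rcases mul_eq_zero.1 e3 with h | h
      · exact absurd h (mul_ne_zero hk₀ hd)
      · linarith
    have e5 := congrArg Real.log e4
    rw [Real.log_rpow (by norm_num), Real.log_one] at e5
    rcases mul_eq_zero.1 e5 with h | h
    · exact hk₁ (by linarith)
    · exact (Real.log_pos (by norm_num : (1 : ℝ) < 2)).ne' h
  · simpa using h2

/-! ### Isolated points and arcs -/

/-- The points of `S` that lie on no arc in `S` other than a singleton. -/
def isolatedPoints {X : Type*} [TopologicalSpace X] (S : Set X) : Set X :=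
  {z | z ∈ S ∧ ∀ A : Set X, IsArc A → A ⊆ S → z ∈ A → A = {z}}

theorem isolatedPoints_subset {X : Type*} [TopologicalSpace X] (S : Set X) :
    isolatedPoints S ⊆ S :=
  fun _ h => h.1

theorem isArc_image_Icc {X : Type*} [TopologicalSpace X] [T2Space X] {γ : ℝ → X} {a b : ℝ}
    (hab : a < b) (hc : ContinuousOn γ (Set.Icc a b)) (hi : Set.InjOn γ (Set.Icc a b)) :
    IsArc (γ '' Set.Icc a b) := by
  refine Or.inr (Or.inr (Or.inr (Or.inl ⟨?_⟩)))
  have hcont : Continuous (Equiv.Set.imageOfInjOn γ (Set.Icc a b) hi) :=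
    Continuous.subtype_mk (continuousOn_iff_continuous_domRestrict.1 hc) _
  exact (iccHomeoI a b hab).symm.trans hcont.homeoOfEquivCompactToT2

theorem notMem_isolatedPoints {X : Type*} [TopologicalSpace X] [T2Space X] {S : Set X}
    {γ : ℝ → X} {a b t : ℝ} (hab : a < b) (hc : ContinuousOn γ (Set.Icc a b))
    (hi : Set.InjOn γ (Set.Icc a b)) (hS : ∀ s ∈ Set.Icc a b, γ s ∈ S) (ht : t ∈ Set.Icc a b) :
    γ t ∉ isolatedPoints S := by
  rintro ⟨-, h⟩
  have hA := h _ (isArc_image_Icc hab hc hi) (Set.image_subset_iff.2 hS)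
    (Set.mem_image_of_mem γ ht)
  have ha : γ a ∈ γ '' Set.Icc a b := Set.mem_image_of_mem γ (Set.left_mem_Icc.2 hab.le)
  have hb : γ b ∈ γ '' Set.Icc a b := Set.mem_image_of_mem γ (Set.right_mem_Icc.2 hab.le)
  rw [hA] at ha hb
  exact hab.ne (hi (Set.left_mem_Icc.2 hab.le) (Set.right_mem_Icc.2 hab.le)
    ((Set.mem_singleton_iff.1 ha).trans (Set.mem_singleton_iff.1 hb).symm))

theorem IsArc.isPreconnected {X : Type*} [TopologicalSpace X] {A : Set X} (hA : IsArc A) :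
    IsPreconnected A := by
  have key : ∀ {Y : Type} [TopologicalSpace Y] [PreconnectedSpace Y], Y ≃ₜ A →
      IsPreconnected A := fun e => by
    have h := isPreconnected_range (continuous_subtype_val.comp e.continuous)
    rwa [Set.range_comp, e.surjective.range_eq, Set.image_univ, Subtype.range_coe] at h
  have hs : ∀ s : Set ℝ, s.OrdConnected → PreconnectedSpace s := fun s hs =>
    isPreconnected_iff_preconnectedSpace.1 hs.isPreconnected
  rcases hA with ⟨p, rfl⟩ | ⟨⟨e⟩⟩ | ⟨⟨e⟩⟩ | ⟨⟨e⟩⟩ | ⟨⟨e⟩⟩ | ⟨⟨e⟩⟩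
  · exact isPreconnected_singleton
  · exact key e
  · have := hs (Set.Ioo 0 1) Set.ordConnected_Ioo
    exact key e
  · have := hs (Set.Icc 0 1) Set.ordConnected_Icc
    exact key e
  · have := hs (Set.Ico 0 1) Set.ordConnected_Ico
    exact key e
  · have := hs (Set.Ioc 0 1) Set.ordConnected_Ioc
    exact key e

theorem isolatedPoints_of_finite {X : Type*} [MetricSpace X] {S : Set X}
    (hS : S.Finite) : isolatedPoints S = S := by
  refine (isolatedPoints_subset S).antisymm fun z hz => ⟨hz, fun A hA hAS hzA => ?_⟩
  have hfin : A.Finite := hS.subset hAS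
  have hsub : A.Subsingleton :=
    hfin.countable.isTotallyDisconnected A Set.Subset.rfl hA.isPreconnected
  exact hsub.eq_singleton_of_mem hzA

/-! ### Monomials with real exponents in the positive quadrant -/

/-- The monomial `x₁ ^ a₁ x₂ ^ a₂`. -/
def mon (a x : Fin 2 → ℝ) : ℝ := ∏ i, x i ^ a i

theorem mon_eq_exp (a : Fin 2 → ℝ) {x : Fin 2 → ℝ} (hx : ∀ i, 0 < x i) :
    mon a x = Real.exp (a 0 * Real.log (x 0) + a 1 * Real.log (x 1)) := by
  rw [mon, Fin.prod_univ_two, Real.rpow_def_of_pos (hx 0), Real.rpow_def_of_pos (hx 1),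
    ← Real.exp_add]
  ring_nf

theorem mon_pos (a : Fin 2 → ℝ) {x : Fin 2 → ℝ} (hx : ∀ i, 0 < x i) : 0 < mon a x := by
  rw [mon_eq_exp a hx]
  exact Real.exp_pos _

/-- A linear relation between exponents is a multiplicative relation between monomials. -/
theorem mon_eq_of_sub_eq {a b u w : Fin 2 → ℝ} {i j : ℝ} (h : a - b = i • u + j • w)
    {x : Fin 2 → ℝ} (hx : ∀ i, 0 < x i) :
    mon a x = mon b x * (mon u x ^ i * mon w x ^ j) := by
  have h0 := congrFun h 0
  have h1 := congrFun h 1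
  simp only [Pi.sub_apply, Pi.add_apply, Pi.smul_apply, smul_eq_mul] at h0 h1
  rw [mon_eq_exp a hx, mon_eq_exp b hx, mon_eq_exp u hx, mon_eq_exp w hx, ← Real.exp_mul,
    ← Real.exp_mul, ← Real.exp_add, ← Real.exp_add]
  congr 1
  linear_combination Real.log (x 0) * h0 + Real.log (x 1) * h1

/-- The determinant of two vectors of the plane. -/
def cross (u w : Fin 2 → ℝ) : ℝ := u 0 * w 1 - u 1 * w 0

theorem exists_eq_smul_of_cross_eq_zero {u w : Fin 2 → ℝ} (hu : u ≠ 0) (h : cross u w = 0) :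
    ∃ k : ℝ, w = k • u := by
  unfold cross at h
  by_cases h0 : u 0 = 0
  · have h1 : u 1 ≠ 0 := fun h1 => hu (by ext i; fin_cases i <;> simp [h0, h1])
    refine ⟨w 1 / u 1, ?_⟩
    have : w 0 = 0 := by
      rw [h0] at h
      have : u 1 * w 0 = 0 := by linarith
      exact (mul_eq_zero.1 this).resolve_left h1
    ext i
    fin_cases i
    · simp [h0, this]
    · simp [h1]
  · refine ⟨w 0 / u 0, ?_⟩
    ext i
    fin_cases i
    · simp [h0]
    · simp only [Fin.mk_one, Pi.smul_apply, smul_eq_mul]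
      field_simp
      linarith

theorem exists_eq_smul_add_smul {u w : Fin 2 → ℝ} (h : cross u w ≠ 0) (v : Fin 2 → ℝ) :
    ∃ i j : ℝ, v = i • u + j • w := by
  refine ⟨cross v w / cross u w, cross u v / cross u w, ?_⟩
  ext i
  fin_cases i
  all_goals
    simp only [Fin.zero_eta, Fin.mk_one, Pi.add_apply, Pi.smul_apply, smul_eq_mul]
    rw [div_mul_eq_mul_div, div_mul_eq_mul_div, ← add_div, eq_div_iff h]
    unfold cross
    ring

/-- The inverse of the monomial change of coordinates `x ↦ (x ^ u, x ^ w)`. -/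
def monInv (u w : Fin 2 → ℝ) (t s : ℝ) : Fin 2 → ℝ :=
  ![Real.exp ((w 1 * Real.log t - u 1 * Real.log s) / cross u w),
    Real.exp ((u 0 * Real.log s - w 0 * Real.log t) / cross u w)]

theorem monInv_pos (u w : Fin 2 → ℝ) (t s : ℝ) (i : Fin 2) : 0 < monInv u w t s i := by
  fin_cases i <;> simp [monInv, Real.exp_pos]

theorem mon_monInv_left {u w : Fin 2 → ℝ} (h : cross u w ≠ 0) {t s : ℝ} (ht : 0 < t) :
    mon u (monInv u w t s) = t := by
  rw [mon_eq_exp _ (monInv_pos u w t s)]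
  simp only [monInv, Matrix.cons_val_zero, Matrix.cons_val_one, Real.log_exp]
  rw [← Real.exp_log ht]
  congr 1
  rw [Real.log_exp]
  field_simp
  unfold cross
  ring

theorem mon_monInv_right {u w : Fin 2 → ℝ} (h : cross u w ≠ 0) {t s : ℝ} (hs : 0 < s) :
    mon w (monInv u w t s) = s := by
  rw [mon_eq_exp _ (monInv_pos u w t s)]
  simp only [monInv, Matrix.cons_val_zero, Matrix.cons_val_one, Real.log_exp]
  rw [← Real.exp_log hs]
  congr 1
  rw [Real.log_exp]
  field_simp
  unfold cross
  ring

theorem monInv_mon {u w x : Fin 2 → ℝ} (h : cross u w ≠ 0) (hx : ∀ i, 0 < x i) :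
    monInv u w (mon u x) (mon w x) = x := by
  ext i
  rw [← Real.exp_log (hx i), mon_eq_exp u hx, mon_eq_exp w hx]
  fin_cases i
  all_goals
    simp only [monInv, Fin.zero_eta, Fin.mk_one, Matrix.cons_val_zero, Matrix.cons_val_one,
      Real.log_exp]
    congr 1
    field_simp
    unfold cross
    ring

theorem continuousOn_monInv_affine (u w : Fin 2 → ℝ) (p q : ℝ) :
    ContinuousOn (fun t => monInv u w t (p + q * t)) (posInterval p q) := by
  have h1 : ContinuousOn (fun t : ℝ => Real.log t) (posInterval p q) :=
    continuousOn_id.log fun t ht => ht.1.ne'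
  have h2 : ContinuousOn (fun t : ℝ => Real.log (p + q * t)) (posInterval p q) :=
    ContinuousOn.log (by fun_prop) fun t ht => ht.2.ne'
  refine continuousOn_pi.2 fun i => ?_
  fin_cases i
  all_goals
    simp only [monInv, Fin.zero_eta, Fin.mk_one, Matrix.cons_val_zero, Matrix.cons_val_one]
    fun_prop

/-! ### Common roots of two trinomials -/

/-- The common positive roots of `∑ c j x ^ α j` and `∑ d j x ^ β j`. -/
def rootSet (α : Fin 3 → Fin 2 → ℝ) (c : Fin 3 → ℝ) (β : Fin 3 → Fin 2 → ℝ) (d : Fin 3 → ℝ) :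
    Set (Fin 2 → ℝ) :=
  {x | (∀ i, 0 < x i) ∧ ∑ j, c j * mon (α j) x = 0 ∧ ∑ j, d j * mon (β j) x = 0}

theorem rootSet_swap (α : Fin 3 → Fin 2 → ℝ) (c : Fin 3 → ℝ) (β : Fin 3 → Fin 2 → ℝ)
    (d : Fin 3 → ℝ) : rootSet α c β d = rootSet β d α c := by
  ext x
  simp only [rootSet, Set.mem_ofPred_eq]
  tauto

theorem rootSet_comp_perm (α : Fin 3 → Fin 2 → ℝ) (c : Fin 3 → ℝ) (β : Fin 3 → Fin 2 → ℝ)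
    (d : Fin 3 → ℝ) (σ τ : Equiv.Perm (Fin 3)) :
    rootSet (α ∘ σ) (c ∘ σ) (β ∘ τ) (d ∘ τ) = rootSet α c β d := by
  ext x
  simp only [rootSet, Set.mem_ofPred_eq, Function.comp]
  rw [Equiv.sum_comp σ fun j => c j * mon (α j) x, Equiv.sum_comp τ fun j => d j * mon (β j) x]

/-- A trinomial equation is affine in the quotients of its monomials. -/
theorem sum_mon_eq {α : Fin 3 → Fin 2 → ℝ} (d : Fin 3 → ℝ) {u w : Fin 2 → ℝ} {i₁ j₁ i₂ j₂ : ℝ}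
    (h₁ : α 1 - α 0 = i₁ • u + j₁ • w) (h₂ : α 2 - α 0 = i₂ • u + j₂ • w) {x : Fin 2 → ℝ}
    (hx : ∀ i, 0 < x i) :
    ∑ j, d j * mon (α j) x = mon (α 0) x *
      (d 0 + d 1 * (mon u x ^ i₁ * mon w x ^ j₁) + d 2 * (mon u x ^ i₂ * mon w x ^ j₂)) := by
  rw [Fin.sum_univ_three, mon_eq_of_sub_eq h₁ hx, mon_eq_of_sub_eq h₂ hx]
  ring

/-- If the first trinomial has affinely independent exponents, its zero set is an arc
`t ↦ (t, p + q t)` in monomial coordinates, and it suffices to count the zeros of the second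
trinomial along it; if that one vanishes identically along the arc, no root is isolated. -/
theorem encard_isolatedPoints_rootSet_le {α β : Fin 3 → Fin 2 → ℝ} {c d : Fin 3 → ℝ}
    (hα : cross (α 1 - α 0) (α 2 - α 0) ≠ 0) (hc : c 2 ≠ 0) {i₁ j₁ i₂ j₂ : ℝ}
    (h₁ : β 1 - β 0 = i₁ • (α 1 - α 0) + j₁ • (α 2 - α 0))
    (h₂ : β 2 - β 0 = i₂ • (α 1 - α 0) + j₂ • (α 2 - α 0)) {n : ℕ}
    (h : ∀ p q, ZerosLE n (fun t => d 0 + d 1 * linMonomial p q i₁ j₁ t +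
      d 2 * linMonomial p q i₂ j₂ t) (posInterval p q)) :
    (isolatedPoints (rootSet α c β d)).encard ≤ n := by
  set u := α 1 - α 0 with hu
  set w := α 2 - α 0 with hw
  set p := -c 0 / c 2 with hp
  set q := -c 1 / c 2 with hq
  set g : ℝ → ℝ := fun t => d 0 + d 1 * linMonomial p q i₁ j₁ t + d 2 * linMonomial p q i₂ j₂ t
    with hg
  set γ : ℝ → Fin 2 → ℝ := fun t => monInv u w t (p + q * t) with hγ
  have hα₁ : α 1 - α 0 = (1 : ℝ) • u + (0 : ℝ) • w := by simp [hu]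
  have hα₂ : α 2 - α 0 = (0 : ℝ) • u + (1 : ℝ) • w := by simp [hw]
  have hroot : ∀ t ∈ posInterval p q, g t = 0 → γ t ∈ rootSet α c β d := by
    intro t ht hgt
    have hpos := monInv_pos u w t (p + q * t)
    have e1 : mon u (γ t) = t := mon_monInv_left hα ht.1
    have e2 : mon w (γ t) = p + q * t := mon_monInv_right hα ht.2
    refine ⟨hpos, ?_, ?_⟩
    · rw [sum_mon_eq c hα₁ hα₂ hpos, e1, e2]
      simp only [Real.rpow_one, Real.rpow_zero, mul_one, one_mul]
      rw [mul_eq_zero]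
      right
      rw [hp, hq]
      field_simp
      ring
    · rw [sum_mon_eq d h₁ h₂ hpos, e1, e2, mul_eq_zero]
      exact Or.inr hgt
  have hparam : ∀ x ∈ rootSet α c β d, mon u x ∈ posInterval p q ∧ g (mon u x) = 0 ∧
      γ (mon u x) = x := by
    rintro x ⟨hx, hf₁, hf₂⟩
    have e : mon w x = p + q * mon u x := by
      rw [sum_mon_eq c hα₁ hα₂ hx, mul_eq_zero] at hf₁
      have hf := hf₁.resolve_left (mon_pos _ hx).ne'
      simp only [Real.rpow_one, Real.rpow_zero, mul_one, one_mul] at hf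
      rw [hp, hq]
      field_simp
      linarith
    refine ⟨⟨mon_pos u hx, e ▸ mon_pos w hx⟩, ?_, ?_⟩
    · rw [sum_mon_eq d h₁ h₂ hx, mul_eq_zero, e] at hf₂
      exact hf₂.resolve_left (mon_pos _ hx).ne'
    · rw [hγ]
      simp only
      rw [← e]
      exact monInv_mon hα hx
  have hinj : Set.InjOn γ (posInterval p q) := by
    intro t ht s hs hts
    have e1 : mon u (γ t) = t := mon_monInv_left hα ht.1
    have e2 : mon u (γ s) = s := mon_monInv_left hα hs.1
    rw [← e1, ← e2, hts]
  rcases h p q with h | h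
  · have : isolatedPoints (rootSet α c β d) = ∅ := by
      refine Set.eq_empty_of_forall_notMem fun x hx => ?_
      obtain ⟨ht, -, hxt⟩ := hparam x hx.1
      obtain ⟨ε, hε, hball⟩ := Metric.isOpen_iff.1 (isOpen_posInterval p q) _ ht
      have hsub : Set.Icc (mon u x - ε / 2) (mon u x + ε / 2) ⊆ posInterval p q := by
        rw [← Real.closedBall_eq_Icc]
        exact (Metric.closedBall_subset_ball (by linarith)).trans hball
      rw [← hxt] at hx
      exact notMem_isolatedPoints (by linarith)
        ((continuousOn_monInv_affine u w p q).mono hsub) (hinj.mono hsub)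
        (fun s hs => hroot s (hsub hs) (h s (hsub hs))) ⟨by linarith, by linarith⟩ hx
    simp [this]
  · refine (Set.encard_le_encard ((isolatedPoints_subset _).trans fun x hx => ?_)).trans
      ((Set.encard_image_le γ _).trans h)
    obtain ⟨ht, hgt, hxt⟩ := hparam x hx
    exact ⟨mon u x, ⟨ht, hgt⟩, hxt⟩

theorem encard_isolatedPoints_le_four_of_parallel {α β : Fin 3 → Fin 2 → ℝ} {c d : Fin 3 → ℝ}
    (hα : cross (α 1 - α 0) (α 2 - α 0) ≠ 0) (hc : c 2 ≠ 0) {k : ℝ}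
    (h : β 1 - β 0 = k • (α 1 - α 0)) : (isolatedPoints (rootSet α c β d)).encard ≤ 4 := by
  obtain ⟨i, j, hij⟩ := exists_eq_smul_add_smul hα (β 2 - β 0)
  have h₁ : β 1 - β 0 = k • (α 1 - α 0) + (0 : ℝ) • (α 2 - α 0) := by simp [h]
  exact encard_isolatedPoints_rootSet_le hα hc h₁ hij
    fun p q => zerosLE_four_of_parallel p q _ _ _ k i j

theorem encard_isolatedPoints_le_two_of_homothetic {α β : Fin 3 → Fin 2 → ℝ} {c d : Fin 3 → ℝ}
    (hα : cross (α 1 - α 0) (α 2 - α 0) ≠ 0) (hc : c 2 ≠ 0) {k : ℝ}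
    (h₁ : β 1 - β 0 = k • (α 1 - α 0)) (h₂ : β 2 - β 0 = k • (α 2 - α 0)) :
    (isolatedPoints (rootSet α c β d)).encard ≤ 2 := by
  have h₁' : β 1 - β 0 = k • (α 1 - α 0) + (0 : ℝ) • (α 2 - α 0) := by simp [h₁]
  have h₂' : β 2 - β 0 = (0 : ℝ) • (α 1 - α 0) + k • (α 2 - α 0) := by simp [h₂]
  exact encard_isolatedPoints_rootSet_le hα hc h₁' h₂'
    fun p q => zerosLE_two_of_homothetic p q _ _ _ k

theorem encard_isolatedPoints_le_four_of_collinear {α β : Fin 3 → Fin 2 → ℝ} {c d : Fin 3 → ℝ}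
    (hα : cross (α 1 - α 0) (α 2 - α 0) ≠ 0) (hc : c 2 ≠ 0) {k : ℝ}
    (h : β 2 - β 0 = k • (β 1 - β 0)) : (isolatedPoints (rootSet α c β d)).encard ≤ 4 := by
  obtain ⟨i, j, hij⟩ := exists_eq_smul_add_smul hα (β 1 - β 0)
  have h₂ : β 2 - β 0 = (k * i) • (α 1 - α 0) + (k * j) • (α 2 - α 0) := by
    rw [h, hij, smul_add, smul_smul, smul_smul]
  exact encard_isolatedPoints_rootSet_le hα hc hij h₂
    fun p q => zerosLE_four_of_collinear p q _ _ _ i j k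

/-- Two univariate trinomials in independent monomials. -/
theorem encard_isolatedPoints_le_four_of_collinear_of_collinear {α β : Fin 3 → Fin 2 → ℝ}
    {c d : Fin 3 → ℝ} (h : cross (α 1 - α 0) (β 1 - β 0) ≠ 0)
    (hα : Function.Injective α) (hβ : Function.Injective β) (hc : c 2 ≠ 0) (hd : d 2 ≠ 0)
    {k l : ℝ} (hk : α 2 - α 0 = k • (α 1 - α 0)) (hl : β 2 - β 0 = l • (β 1 - β 0)) :
    (isolatedPoints (rootSet α c β d)).encard ≤ 4 := by
  have key : ∀ {α : Fin 3 → Fin 2 → ℝ} {c : Fin 3 → ℝ} {k : ℝ}, Function.Injective α →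
      c 2 ≠ 0 → α 2 - α 0 = k • (α 1 - α 0) →
      {t : ℝ | 0 < t ∧ c 0 + c 1 * t + c 2 * t ^ k = 0}.encard ≤ 2 := by
    intro α c k hα hc hk
    refine encard_zeros_trinomial_le _ _ hc ?_ ?_
    · rintro rfl
      rw [zero_smul, sub_eq_zero] at hk
      exact absurd (hα hk) (by decide)
    · rintro rfl
      rw [one_smul, sub_left_inj] at hk
      exact absurd (hα hk) (by decide)
  have hsum : ∀ {α : Fin 3 → Fin 2 → ℝ} {c : Fin 3 → ℝ} {k : ℝ} {x : Fin 2 → ℝ},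
      (∀ i, 0 < x i) → α 2 - α 0 = k • (α 1 - α 0) → ∑ j, c j * mon (α j) x = 0 →
      c 0 + c 1 * mon (α 1 - α 0) x + c 2 * mon (α 1 - α 0) x ^ k = 0 := by
    intro α c k x hx hk h0
    have e1 : α 1 - α 0 = (1 : ℝ) • (α 1 - α 0) + (0 : ℝ) • (α 1 - α 0) := by simp
    have e2 : α 2 - α 0 = k • (α 1 - α 0) + (0 : ℝ) • (α 1 - α 0) := by simp [hk]
    rw [sum_mon_eq c e1 e2 hx, mul_eq_zero] at h0
    have := h0.resolve_left (mon_pos _ hx).ne'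
    simpa using this
  have h2 := mul_le_mul' (key hα hc hk) (key hβ hd hl)
  rw [← Set.encard_prod] at h2
  refine (Set.encard_le_encard ((isolatedPoints_subset _).trans ?_)).trans
    ((Set.encard_image_le (fun z : ℝ × ℝ => monInv (α 1 - α 0) (β 1 - β 0) z.1 z.2) _).trans
      (h2.trans (by norm_num)))
  rintro x ⟨hx, hf, hg⟩
  exact ⟨(mon (α 1 - α 0) x, mon (β 1 - β 0) x), ⟨⟨mon_pos _ hx, hsum hx hk hf⟩,
    ⟨mon_pos _ hx, hsum hx hl hg⟩⟩, monInv_mon h hx⟩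

/-- If all exponents lie in one direction, the root set is a union of translates of a
one-parameter group. -/
theorem isolatedPoints_eq_empty_of_parallel {α β : Fin 3 → Fin 2 → ℝ} {c d : Fin 3 → ℝ}
    {γ : Fin 2 → ℝ} (hγ : γ ≠ 0) (hα : ∀ j, ∃ k : ℝ, α j - α 0 = k • γ)
    (hβ : ∀ j, ∃ k : ℝ, β j - β 0 = k • γ) : isolatedPoints (rootSet α c β d) = ∅ := by
  refine Set.eq_empty_of_forall_notMem fun z hz => ?_
  obtain ⟨hz0, hf, hg⟩ := hz.1
  set δ : ℝ → Fin 2 → ℝ := fun s => ![z 0 * Real.exp (-(s * γ 1)), z 1 * Real.exp (s * γ 0)]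
    with hδ
  have hδ0 : δ 0 = z := by
    ext i
    fin_cases i <;> simp [hδ]
  have hpos : ∀ s i, 0 < δ s i := by
    intro s i
    fin_cases i
    · exact mul_pos (hz0 0) (Real.exp_pos _)
    · exact mul_pos (hz0 1) (Real.exp_pos _)
  have hmon : ∀ a s, mon a (δ s) = mon a z * Real.exp (s * cross γ a) := by
    intro a s
    rw [mon_eq_exp a (hpos s), mon_eq_exp a hz0, ← Real.exp_add]
    congr 1
    simp only [hδ, Matrix.cons_val_zero, Matrix.cons_val_one]
    rw [Real.log_mul (hz0 0).ne' (Real.exp_pos _).ne',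
      Real.log_mul (hz0 1).ne' (Real.exp_pos _).ne', Real.log_exp, Real.log_exp]
    unfold cross
    ring
  have hcross : ∀ {a b : Fin 2 → ℝ} {k : ℝ}, a - b = k • γ → cross γ a = cross γ b := by
    intro a b k hab
    have h0 := congrFun hab 0
    have h1 := congrFun hab 1
    simp only [Pi.sub_apply, Pi.smul_apply, smul_eq_mul] at h0 h1
    unfold cross
    linear_combination γ 0 * h1 - γ 1 * h0
  have hsum : ∀ {α : Fin 3 → Fin 2 → ℝ} {c : Fin 3 → ℝ} (s : ℝ),
      (∀ j, ∃ k : ℝ, α j - α 0 = k • γ) → ∑ j, c j * mon (α j) z = 0 →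
      ∑ j, c j * mon (α j) (δ s) = 0 := by
    intro α c s hα h0
    have : ∀ j, c j * mon (α j) (δ s) = c j * mon (α j) z * Real.exp (s * cross γ (α 0)) := by
      intro j
      obtain ⟨k, hk⟩ := hα j
      rw [hmon, hcross hk, mul_assoc]
    rw [Finset.sum_congr rfl fun j _ => this j, ← Finset.sum_mul, h0, zero_mul]
  have hcont : Continuous δ := by
    refine continuous_pi fun i => ?_
    fin_cases i
    all_goals
      simp only [hδ, Fin.zero_eta, Fin.mk_one, Matrix.cons_val_zero, Matrix.cons_val_one]
      fun_prop
  have hinj : Function.Injective δ := by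
    intro s s' hs
    have e0 := congrFun hs 0
    have e1 := congrFun hs 1
    simp only [hδ, Matrix.cons_val_zero, Matrix.cons_val_one] at e0 e1
    have e0' := Real.exp_injective (mul_left_cancel₀ (hz0 0).ne' e0)
    have e1' := Real.exp_injective (mul_left_cancel₀ (hz0 1).ne' e1)
    by_contra hne
    refine hγ ?_
    ext i
    have hne' := sub_ne_zero.2 hne
    fin_cases i
    · exact (mul_eq_zero.1 (by linear_combination e1' : (s - s') * γ 0 = 0)).resolve_left hne'
    · exact (mul_eq_zero.1 (by linear_combination -e0' : (s - s') * γ 1 = 0)).resolve_left hne'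
  have := notMem_isolatedPoints (S := rootSet α c β d) (γ := δ) (t := 0) (zero_lt_one (α := ℝ))
    hcont.continuousOn hinj.injOn (fun s _ => ⟨hpos s, hsum s hα hf, hsum s hβ hg⟩)
    ⟨le_rfl, zero_le_one⟩
  rw [hδ0] at this
  exact this hz

/-! ### Extreme points and polygons -/

theorem notMem_convexHull_of_forall_lt {E : Type*} [AddCommGroup E] [Module ℝ E] {S : Set E}
    {x : E} (φ : E →ₗ[ℝ] ℝ) (h : ∀ y ∈ S, φ x < φ y) : x ∉ convexHull ℝ S := by
  intro hx
  have hconv : Convex ℝ {y | φ x < φ y} := convex_halfSpace_gt φ.isLinear _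
  have hlt : φ x < φ x := convexHull_min (fun y hy => h y hy) hconv hx
  exact lt_irrefl _ hlt

theorem convexIndependent_of_forall_exists_lt {E ι : Type*} [AddCommGroup E] [Module ℝ E]
    {p : ι → E} (h : ∀ i, ∃ φ : E →ₗ[ℝ] ℝ, ∀ j, j ≠ i → φ (p i) < φ (p j)) :
    ConvexIndependent ℝ p := by
  intro s i hi
  by_contra his
  obtain ⟨φ, hφ⟩ := h i
  refine notMem_convexHull_of_forall_lt φ ?_ hi
  rintro _ ⟨j, hj, rfl⟩
  exact hφ j fun hji => his (hji ▸ hj)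

theorem convexHull_extremePoints_of_finite {E : Type*} [AddCommGroup E] [Module ℝ E]
    [TopologicalSpace E] [T2Space E] [IsTopologicalAddGroup E] [ContinuousSMul ℝ E]
    [LocallyConvexSpace ℝ E] {S : Set E} (hS : S.Finite) :
    convexHull ℝ ((convexHull ℝ S).extremePoints ℝ) = convexHull ℝ S := by
  have h := closure_convexHull_extremePoints (hS.isCompact_convexHull ℝ) (convex_convexHull ℝ S)
  rwa [(hS.subset extremePoints_convexHull_subset).isClosed_convexHull ℝ |>.closure_eq] at h

theorem extremePoints_convexHull_range {E ι : Type*} [AddCommGroup E] [Module ℝ E]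
    [TopologicalSpace E] [T2Space E] [IsTopologicalAddGroup E] [ContinuousSMul ℝ E]
    [LocallyConvexSpace ℝ E] [Finite ι] {v : ι → E} (hv : ConvexIndependent ℝ v) :
    (convexHull ℝ (Set.range v)).extremePoints ℝ = Set.range v := by
  refine extremePoints_convexHull_subset.antisymm ?_
  rintro _ ⟨i, rfl⟩
  by_contra hi
  have hsub : (convexHull ℝ (Set.range v)).extremePoints ℝ ⊆ v '' {i}ᶜ := by
    intro x hx
    obtain ⟨j, rfl⟩ := extremePoints_convexHull_subset hx
    exact ⟨j, fun hji => hi (Set.mem_singleton_iff.1 hji ▸ hx), rfl⟩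
  have hmem : v i ∈ convexHull ℝ (v '' {i}ᶜ) :=
    convexHull_mono hsub ((convexHull_extremePoints_of_finite (Set.finite_range v)).symm ▸
      subset_convexHull ℝ _ (Set.mem_range_self i))
  exact hv {i}ᶜ i hmem rfl

theorem IsPolygon.ncard_extremePoints {l : ℕ} {P : Set (Fin 2 → ℝ)} (h : IsPolygon l P) :
    (P.extremePoints ℝ).ncard = l := by
  obtain ⟨-, v, hv, rfl⟩ := h
  rw [extremePoints_convexHull_range hv, ← Set.image_univ,
    Set.ncard_image_of_injective _ hv.injective, Set.ncard_univ, Nat.card_fin]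

theorem isPolygon_convexHull_of_ncard {l : ℕ} (hl : 3 ≤ l) {S : Set (Fin 2 → ℝ)}
    (hS : S.Finite) (h : ((convexHull ℝ S).extremePoints ℝ).ncard = l) :
    IsPolygon l (convexHull ℝ S) := by
  have hfin : ((convexHull ℝ S).extremePoints ℝ).Finite :=
    hS.subset extremePoints_convexHull_subset
  have : Finite ((convexHull ℝ S).extremePoints ℝ) := hfin
  let e : Fin l ≃ (convexHull ℝ S).extremePoints ℝ :=
    (finCongr (by rw [← h]; rfl)).trans (Finite.equivFin _).symm
  refine ⟨hl, fun i => (e i : Fin 2 → ℝ), ?_, ?_⟩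
  · exact (convex_convexHull ℝ S).convexIndependent_extremePoints.comp_embedding e.toEmbedding
  · refine (convexHull_extremePoints_of_finite hS).symm.trans (congrArg _ ?_)
    ext x
    exact ⟨fun hx => ⟨e.symm ⟨x, hx⟩, by simp⟩, by rintro ⟨i, rfl⟩; exact (e i).2⟩

/-! ### Minkowski sums of triangles without parallel edges -/

/-- `cross u` as a linear functional. -/
def crossₗ (u : Fin 2 → ℝ) : (Fin 2 → ℝ) →ₗ[ℝ] ℝ where
  toFun := cross u
  map_add' x y := by simp only [cross, Pi.add_apply]; ring
  map_smul' r x := by simp only [cross, Pi.smul_apply, smul_eq_mul, RingHom.id_apply]; ring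

theorem crossₗ_apply (u w : Fin 2 → ℝ) : crossₗ u w = cross u w := rfl

/-- The edge vectors of a triangle. -/
def edge (α : Fin 3 → Fin 2 → ℝ) (i : Fin 3) : Fin 2 → ℝ := α (i + 1) - α i

theorem eq_or_eq_add_one_or_eq_add_two (i k : Fin 3) : k = i ∨ k = i + 1 ∨ k = i + 2 := by
  decide +revert

theorem fin_three_add_two_add_one (i : Fin 3) : i + 2 + 1 = i := by
  decide +revert

theorem edge_add_two (α : Fin 3 → Fin 2 → ℝ) (i : Fin 3) :
    edge α (i + 2) = α i - α (i + 2) := by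
  rw [edge, fin_three_add_two_add_one]

/-- All consecutive pairs of edges span the same oriented area. -/
theorem cross_edge_edge (α : Fin 3 → Fin 2 → ℝ) (i : Fin 3) :
    cross (edge α i) (edge α (i + 1)) = cross (α 1 - α 0) (α 2 - α 0) := by
  fin_cases i <;> simp [edge, cross] <;> ring

theorem cross_edge_add_two_edge (α : Fin 3 → Fin 2 → ℝ) (i : Fin 3) :
    cross (edge α (i + 2)) (edge α i) = cross (α 1 - α 0) (α 2 - α 0) := by
  rw [← cross_edge_edge α (i + 2), fin_three_add_two_add_one]

theorem edge_sum (α : Fin 3 → Fin 2 → ℝ) : edge α 0 + edge α 1 + edge α 2 = 0 := by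
  simp [edge]

/-- The sign pattern of a vertex of the Minkowski sum of two positively oriented triangles. Here
`s i j` says that the `i`-th edge of the first triangle turns left into the `j`-th edge of the
second. The four edge vectors leaving the sum of the vertices `i` and `j` lie in an open half
plane; the alternatives say which of them bound the cone that they span. -/
def vertexPattern (s : Fin 3 → Fin 3 → Bool) (i j : Fin 3) : Prop :=
  (s i j ∧ s (i + 2) j ∧ !s i (j + 2) ∧ !s (i + 2) (j + 2)) ∨
  (s i j ∧ !s i (j + 2) ∧ s (i + 2) (j + 2)) ∨
  (!s i j ∧ s (i + 2) j ∧ !s (i + 2) (j + 2)) ∨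
  (!s i j ∧ s (i + 2) j ∧ !s i (j + 2) ∧ s (i + 2) (j + 2))

/-- The sign pattern of a sum of two vertices that is not a vertex of the Minkowski sum: the
negative of one of the four edge vectors leaving it lies in the angle of the other triangle. -/
def innerPattern (s : Fin 3 → Fin 3 → Bool) (i j : Fin 3) : Prop :=
  (s i j ∧ s i (j + 2)) ∨ (!s (i + 2) j ∧ !s (i + 2) (j + 2)) ∨
  (!s i j ∧ !s (i + 2) j) ∨ (s i (j + 2) ∧ s (i + 2) (j + 2))

instance (s : Fin 3 → Fin 3 → Bool) (i j : Fin 3) : Decidable (vertexPattern s i j) := by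
  unfold vertexPattern
  infer_instance

instance (s : Fin 3 → Fin 3 → Bool) (i j : Fin 3) : Decidable (innerPattern s i j) := by
  unfold innerPattern
  infer_instance

set_option synthInstance.maxSize 2000 in
/-- The combinatorial core of the hexagon case, checked over all sign patterns. The hypotheses
hold because the edge vectors of each triangle sum to zero and by the Plücker relation. -/
theorem card_vertexPattern : ∀ s : Fin 3 → Fin 3 → Bool,
    (∀ i, (∃ j, s i j) ∧ ∃ j, !s i j) → (∀ j, (∃ i, s i j) ∧ ∃ i, !s i j) →
    (∀ i j, ¬(s i j ≠ s (i + 1) (j + 1) ∧ s i (j + 1) = s (i + 1) j)) →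
    (Finset.univ.filter fun z : Fin 3 × Fin 3 => vertexPattern s z.1 z.2).card = 6 ∧
      ∀ i j, ¬vertexPattern s i j → innerPattern s i j := by
  decide +kernel

theorem lt_of_edge_pos {α : Fin 3 → Fin 2 → ℝ} {i : Fin 3} {φ : (Fin 2 → ℝ) →ₗ[ℝ] ℝ}
    (h₁ : 0 < φ (edge α i)) (h₂ : φ (edge α (i + 2)) < 0) {k : Fin 3} (hk : k ≠ i) :
    φ (α i) < φ (α k) := by
  rw [edge_add_two, map_sub] at h₂
  rw [edge, map_sub] at h₁
  rcases eq_or_eq_add_one_or_eq_add_two i k with rfl | rfl | rfl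
  · exact absurd rfl hk
  · linarith
  · linarith

theorem exists_functional_of_vertexPattern {α β : Fin 3 → Fin 2 → ℝ}
    (hα : 0 < cross (α 1 - α 0) (α 2 - α 0)) (hβ : 0 < cross (β 1 - β 0) (β 2 - β 0))
    (h : ∀ i j, cross (edge α i) (edge β j) ≠ 0) {i j : Fin 3}
    (hv : vertexPattern (fun i j => decide (0 < cross (edge α i) (edge β j))) i j) :
    ∃ φ : (Fin 2 → ℝ) →ₗ[ℝ] ℝ, (∀ k, k ≠ i → φ (α i) < φ (α k)) ∧
      ∀ k, k ≠ j → φ (β j) < φ (β k) := by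
  have hneg : ∀ i j, ¬0 < cross (edge α i) (edge β j) → cross (edge α i) (edge β j) < 0 :=
    fun i j hij => lt_of_le_of_ne (not_lt.1 hij) (h i j)
  have hanti : ∀ u w : Fin 2 → ℝ, cross u w = -cross w u := fun u w => by
    unfold cross
    ring
  have hself : ∀ u : Fin 2 → ℝ, cross u u = 0 := fun u => by
    unfold cross
    ring
  have ha := cross_edge_add_two_edge α i
  have hb := cross_edge_add_two_edge β j
  have ha' := hanti (edge α i) (edge α (i + 2))
  have hb' := hanti (edge β j) (edge β (j + 2))
  have h1 := hanti (edge β j) (edge α i)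
  have h2 := hanti (edge β j) (edge α (i + 2))
  have h3 := hanti (edge β (j + 2)) (edge α i)
  have h4 := hanti (edge β (j + 2)) (edge α (i + 2))
  have key : ∀ φ : (Fin 2 → ℝ) →ₗ[ℝ] ℝ, 0 < φ (edge α i) → φ (edge α (i + 2)) < 0 →
      0 < φ (edge β j) → φ (edge β (j + 2)) < 0 → ∃ φ : (Fin 2 → ℝ) →ₗ[ℝ] ℝ,
      (∀ k, k ≠ i → φ (α i) < φ (α k)) ∧ ∀ k, k ≠ j → φ (β j) < φ (β k) :=
    fun φ p1 p2 p3 p4 => ⟨φ, fun k hk => lt_of_edge_pos p1 p2 hk,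
      fun k hk => lt_of_edge_pos p3 p4 hk⟩
  simp only [vertexPattern, decide_eq_true_eq, Bool.not_eq_true', decide_eq_false_iff_not] at hv
  -- the functional is `cross g - cross h`, where `g` and `h` are the extreme rays of the cone
  rcases hv with ⟨q1, q2, q3, q4⟩ | ⟨q1, q2, q3⟩ | ⟨q1, q2, q3⟩ | ⟨q1, q2, q3, q4⟩
  · replace q3 := hneg _ _ q3
    replace q4 := hneg _ _ q4
    apply key (crossₗ (edge α i) + crossₗ (edge α (i + 2))) <;>
      simp only [LinearMap.add_apply, crossₗ_apply, hself] <;> linarith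
  · replace q2 := hneg _ _ q2
    apply key (crossₗ (edge α i) + crossₗ (edge β (j + 2))) <;>
      simp only [LinearMap.add_apply, crossₗ_apply, hself] <;> linarith
  · replace q1 := hneg _ _ q1
    replace q3 := hneg _ _ q3
    apply key (crossₗ (edge β j) + crossₗ (edge α (i + 2))) <;>
      simp only [LinearMap.add_apply, crossₗ_apply, hself] <;> linarith
  · replace q1 := hneg _ _ q1
    replace q3 := hneg _ _ q3
    apply key (crossₗ (edge β j) + crossₗ (edge β (j + 2))) <;>
      simp only [LinearMap.add_apply, crossₗ_apply, hself] <;> linarith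

theorem add_edge_mem_convexHull (α : Fin 3 → Fin 2 → ℝ) (i : Fin 3) {a b : ℝ} (ha : 0 ≤ a)
    (hb : 0 ≤ b) (hab : a + b ≤ 1) :
    α i + (a • edge α i - b • edge α (i + 2)) ∈ convexHull ℝ (Set.range α) := by
  have hconv := convex_convexHull ℝ (Set.range α)
  have hmem : ∀ k, α k ∈ convexHull ℝ (Set.range α) :=
    fun k => subset_convexHull ℝ _ (Set.mem_range_self k)
  have := hconv.sum_mem (t := Finset.univ) (w := ![1 - a - b, a, b])
    (z := ![α i, α (i + 1), α (i + 2)]) (fun k _ => ?_) ?_ (fun k _ => ?_)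
  · convert this using 1
    rw [Fin.sum_univ_three, edge_add_two, edge]
    simp only [Matrix.cons_val]
    module
  · fin_cases k <;> simp <;> linarith
  · simp only [Fin.sum_univ_three, Matrix.cons_val]
    ring
  · fin_cases k <;> exact hmem _

/-- A sum of two vertices is not a vertex of the Minkowski sum if an opposite pair of directions
points into the two triangles. -/
theorem notMem_extremePoints_of_relation {α β : Fin 3 → Fin 2 → ℝ} {i j : Fin 3}
    {a b a' b' : ℝ} (ha : 0 ≤ a) (hb : 0 ≤ b) (ha' : 0 ≤ a') (hb' : 0 ≤ b')
    (hne : a • edge α i - b • edge α (i + 2) ≠ 0)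
    (h : a • edge α i - b • edge α (i + 2) + (a' • edge β j - b' • edge β (j + 2)) = 0) :
    α i + β j ∉ (convexHull ℝ (Set.range α + Set.range β)).extremePoints ℝ := by
  intro hx
  set ε : ℝ := (1 + a + b + a' + b')⁻¹ with hε
  have hpos : 0 < 1 + a + b + a' + b' := by positivity
  have hε0 : 0 < ε := inv_pos.2 hpos
  have hε1 : ε * (1 + a + b + a' + b') = 1 := inv_mul_cancel₀ hpos.ne'
  have hA := add_edge_mem_convexHull α i (mul_nonneg hε0.le ha) (mul_nonneg hε0.le hb)
    (by nlinarith)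
  have hB := add_edge_mem_convexHull β j (mul_nonneg hε0.le ha') (mul_nonneg hε0.le hb')
    (by nlinarith)
  set y := a • edge α i - b • edge α (i + 2) with hy
  have hy' : a' • edge β j - b' • edge β (j + 2) = -y := (neg_eq_of_add_eq_zero_right h).symm
  have e1 : (ε * a) • edge α i - (ε * b) • edge α (i + 2) = ε • y := by
    rw [hy, smul_sub, smul_smul, smul_smul]
  have e2 : (ε * a') • edge β j - (ε * b') • edge β (j + 2) = -(ε • y) := by
    rw [← smul_neg, ← hy', smul_sub, smul_smul, smul_smul]
  rw [e1] at hA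
  rw [e2] at hB
  rw [convexHull_add] at hx
  have m1 : α i + ε • y + β j ∈ convexHull ℝ (Set.range α) + convexHull ℝ (Set.range β) :=
    Set.add_mem_add hA (subset_convexHull ℝ _ (Set.mem_range_self j))
  have m2 : α i + (β j + -(ε • y)) ∈ convexHull ℝ (Set.range α) + convexHull ℝ (Set.range β) :=
    Set.add_mem_add (subset_convexHull ℝ _ (Set.mem_range_self i)) hB
  have := hx.2 m1 m2 ⟨1 / 2, 1 / 2, by norm_num, by norm_num, by norm_num, by module⟩
  have h0 : ε • y = 0 := by
    have h2 : α i + β j + ε • y = α i + β j := by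
      rw [add_right_comm]
      exact this
    simpa using h2
  exact hne ((smul_eq_zero.1 h0).resolve_left hε0.ne')

/-- The linear relation between three vectors of the plane. -/
theorem cross_smul_add_cyclic (u v w : Fin 2 → ℝ) :
    cross v w • u + cross w u • v + cross u v • w = 0 := by
  ext i
  fin_cases i <;> simp [cross] <;> ring

theorem notMem_extremePoints_of_innerPattern {α β : Fin 3 → Fin 2 → ℝ}
    (hα : 0 < cross (α 1 - α 0) (α 2 - α 0)) (hβ : 0 < cross (β 1 - β 0) (β 2 - β 0))
    (h : ∀ i j, cross (edge α i) (edge β j) ≠ 0) {i j : Fin 3}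
    (hv : innerPattern (fun i j => decide (0 < cross (edge α i) (edge β j))) i j) :
    α i + β j ∉ (convexHull ℝ (Set.range α + Set.range β)).extremePoints ℝ := by
  have ha := cross_edge_add_two_edge α i
  have hb := cross_edge_add_two_edge β j
  have hnz : ∀ a b : ℝ, 0 < a ∨ 0 < b → a • edge α i - b • edge α (i + 2) ≠ 0 := by
    intro a b hab h0
    have c1 : cross (edge α (i + 2)) (a • edge α i - b • edge α (i + 2)) = 0 := by
      rw [h0]; simp [cross]
    have c2 : cross (edge α i) (a • edge α i - b • edge α (i + 2)) = 0 := by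
      rw [h0]; simp [cross]
    have d1 : a * cross (edge α (i + 2)) (edge α i) = 0 := by
      rw [← c1]; simp only [cross, Pi.sub_apply, Pi.smul_apply, smul_eq_mul]; ring
    have d2 : b * cross (edge α (i + 2)) (edge α i) = 0 := by
      rw [← c2]; simp only [cross, Pi.sub_apply, Pi.smul_apply, smul_eq_mul]; ring
    rw [ha] at d1 d2
    have := (mul_eq_zero.1 d1).resolve_right hα.ne'
    have := (mul_eq_zero.1 d2).resolve_right hα.ne'
    rcases hab with h | h <;> linarith
  simp only [innerPattern, decide_eq_true_eq, Bool.not_eq_true', decide_eq_false_iff_not,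
    not_lt] at hv
  rw [← ha] at hα
  rw [← hb] at hβ
  rcases hv with ⟨q1, q2⟩ | ⟨q1, q2⟩ | ⟨q1, q2⟩ | ⟨q1, q2⟩
  · refine notMem_extremePoints_of_relation (a := cross (edge β (j + 2)) (edge β j)) (b := 0)
      (a' := cross (edge α i) (edge β (j + 2))) (b' := cross (edge α i) (edge β j))
      hβ.le le_rfl q2.le q1.le (hnz _ _ (Or.inl hβ)) ?_
    rw [← cross_smul_add_cyclic (edge α i) (edge β j) (-edge β (j + 2))]
    ext m
    simp [cross]
    ring
  · refine notMem_extremePoints_of_relation (a := 0) (b := cross (edge β (j + 2)) (edge β j))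
      (a' := -cross (edge α (i + 2)) (edge β (j + 2))) (b' := -cross (edge α (i + 2)) (edge β j))
      le_rfl hβ.le (by linarith) (by linarith) (hnz _ _ (Or.inr hβ)) ?_
    rw [← cross_smul_add_cyclic (-edge α (i + 2)) (edge β j) (-edge β (j + 2))]
    ext m
    simp [cross]
    ring
  · refine notMem_extremePoints_of_relation (a := -cross (edge α (i + 2)) (edge β j))
      (b := -cross (edge α i) (edge β j)) (a' := cross (edge α (i + 2)) (edge α i)) (b' := 0)
      (by linarith) (by linarith) hα.le le_rfl
      (hnz _ _ (Or.inr (neg_pos.2 (lt_of_le_of_ne q1 (h i j))))) ?_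
    rw [← cross_smul_add_cyclic (edge β j) (edge α i) (-edge α (i + 2))]
    ext m
    simp [cross]
    ring
  · refine notMem_extremePoints_of_relation (a := cross (edge α (i + 2)) (edge β (j + 2)))
      (b := cross (edge α i) (edge β (j + 2)))
      (a' := 0) (b' := cross (edge α (i + 2)) (edge α i))
      q2.le q1.le le_rfl hα.le (hnz _ _ (Or.inl q2)) ?_
    rw [← cross_smul_add_cyclic (-edge β (j + 2)) (edge α i) (-edge α (i + 2))]
    ext m
    simp [cross]
    ring

/-- The Minkowski sum of two triangles without parallel edges is a hexagon: six of the nine sums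
of vertices are extreme. -/
theorem isPolygon_six_of_pos {α β : Fin 3 → Fin 2 → ℝ}
    (hα : 0 < cross (α 1 - α 0) (α 2 - α 0)) (hβ : 0 < cross (β 1 - β 0) (β 2 - β 0))
    (h : ∀ i j, cross (edge α i) (edge β j) ≠ 0) :
    IsPolygon 6 (convexHull ℝ (Set.range α + Set.range β)) := by
  set s : Fin 3 → Fin 3 → Bool := fun i j => decide (0 < cross (edge α i) (edge β j)) with hs
  have hsum₁ : ∀ i, cross (edge α i) (edge β 0) + cross (edge α i) (edge β 1) +
      cross (edge α i) (edge β 2) = 0 := fun i => by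
    simp only [← crossₗ_apply, ← map_add, edge_sum, map_zero]
  have hsum₂ : ∀ j, cross (edge α 0) (edge β j) + cross (edge α 1) (edge β j) +
      cross (edge α 2) (edge β j) = 0 := fun j => by
    have := edge_sum α
    have e0 := congrFun this 0
    have e1 := congrFun this 1
    simp only [Pi.add_apply, Pi.zero_apply] at e0 e1
    unfold cross
    linear_combination edge β j 1 * e0 - edge β j 0 * e1
  have hpl : ∀ i j, 0 < cross (edge α i) (edge β j) * cross (edge α (i + 1)) (edge β (j + 1)) -
      cross (edge α i) (edge β (j + 1)) * cross (edge α (i + 1)) (edge β j) := by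
    intro i j
    have := mul_pos hα hβ
    rw [← cross_edge_edge α i, ← cross_edge_edge β j] at this
    refine this.trans_eq ?_
    unfold cross
    ring
  have hneg : ∀ i j, ¬0 < cross (edge α i) (edge β j) → cross (edge α i) (edge β j) < 0 :=
    fun i j hij => lt_of_le_of_ne (not_lt.1 hij) (h i j)
  obtain ⟨hcard, hinner⟩ := card_vertexPattern s
    (fun i => by
      have := hsum₁ i
      constructor
      · by_contra! hc
        have h0 := hneg i 0 (by simpa [hs] using hc 0)
        have h1 := hneg i 1 (by simpa [hs] using hc 1)
        have h2 := hneg i 2 (by simpa [hs] using hc 2)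
        linarith
      · by_contra! hc
        have h0 : 0 < cross (edge α i) (edge β 0) := by simpa [hs] using hc 0
        have h1 : 0 < cross (edge α i) (edge β 1) := by simpa [hs] using hc 1
        have h2 : 0 < cross (edge α i) (edge β 2) := by simpa [hs] using hc 2
        linarith)
    (fun j => by
      have := hsum₂ j
      constructor
      · by_contra! hc
        have h0 := hneg 0 j (by simpa [hs] using hc 0)
        have h1 := hneg 1 j (by simpa [hs] using hc 1)
        have h2 := hneg 2 j (by simpa [hs] using hc 2)
        linarith
      · by_contra! hc
        have h0 : 0 < cross (edge α 0) (edge β j) := by simpa [hs] using hc 0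
        have h1 : 0 < cross (edge α 1) (edge β j) := by simpa [hs] using hc 1
        have h2 : 0 < cross (edge α 2) (edge β j) := by simpa [hs] using hc 2
        linarith)
    (fun i j => by
      rintro ⟨h1, h2⟩
      have hp := hpl i j
      simp only [hs, ne_eq, decide_eq_decide] at h1 h2
      have hle : cross (edge α i) (edge β j) * cross (edge α (i + 1)) (edge β (j + 1)) ≤ 0 := by
        by_cases hc : 0 < cross (edge α i) (edge β j)
        · have := hneg (i + 1) (j + 1) (by tauto)
          nlinarith
        · have h3 : 0 < cross (edge α (i + 1)) (edge β (j + 1)) := by tauto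
          have := hneg i j hc
          nlinarith
      have hge : 0 ≤ cross (edge α i) (edge β (j + 1)) * cross (edge α (i + 1)) (edge β j) := by
        by_cases hc : 0 < cross (edge α i) (edge β (j + 1))
        · exact (mul_pos hc (h2.1 hc)).le
        · exact (mul_pos_of_neg_of_neg (hneg _ _ hc) (hneg _ _ fun h => hc (h2.2 h))).le
      linarith)
  have hfin : (Set.range α + Set.range β).Finite := (Set.finite_range α).add (Set.finite_range β)
  refine isPolygon_convexHull_of_ncard (by norm_num) hfin ?_
  have hφ : ∀ i j, vertexPattern s i j → ∃ φ : (Fin 2 → ℝ) →ₗ[ℝ] ℝ,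
      ∀ k l, ¬(k = i ∧ l = j) → φ (α i + β j) < φ (α k + β l) := by
    intro i j hv
    obtain ⟨φ, h1, h2⟩ := exists_functional_of_vertexPattern hα hβ h hv
    refine ⟨φ, fun k l hkl => ?_⟩
    rw [map_add, map_add]
    by_cases hk : k = i
    · subst hk
      have := h2 l fun hl => hkl ⟨rfl, hl⟩
      linarith
    · by_cases hl : l = j
      · subst hl
        have := h1 k hk
        linarith
      · have := h1 k hk
        have := h2 l hl
        linarith
  have hE : (convexHull ℝ (Set.range α + Set.range β)).extremePoints ℝ =
      (fun z : Fin 3 × Fin 3 => α z.1 + β z.2) ''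
        (Finset.univ.filter fun z : Fin 3 × Fin 3 => vertexPattern s z.1 z.2 : Finset _) := by
    ext x
    simp only [Finset.coe_filter, Finset.mem_univ, true_and, Set.mem_image, Set.mem_ofPred_eq,
      Prod.exists]
    constructor
    · intro hx
      obtain ⟨_, ⟨i, rfl⟩, _, ⟨j, rfl⟩, rfl⟩ := extremePoints_convexHull_subset hx
      refine ⟨i, j, ?_, rfl⟩
      by_contra hv
      exact notMem_extremePoints_of_innerPattern hα hβ h (hinner i j hv) hx
    · rintro ⟨i, j, hv, rfl⟩
      by_contra hx
      obtain ⟨φ, hφ⟩ := hφ i j hv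
      refine notMem_convexHull_of_forall_lt (x := α i + β j)
        (S := (convexHull ℝ (Set.range α + Set.range β)).extremePoints ℝ) φ ?_ ?_
      · intro y hy
        obtain ⟨_, ⟨k, rfl⟩, _, ⟨l, rfl⟩, rfl⟩ := extremePoints_convexHull_subset hy
        refine hφ k l ?_
        rintro ⟨rfl, rfl⟩
        exact hx hy
      · rw [convexHull_extremePoints_of_finite hfin]
        exact subset_convexHull ℝ _
          (Set.add_mem_add (Set.mem_range_self i) (Set.mem_range_self j))
  rw [hE, Set.InjOn.ncard_image, Set.ncard_coe_finset, hcard]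
  rintro ⟨i, j⟩ hij ⟨k, l⟩ - heq
  simp only [Finset.coe_filter, Finset.mem_univ, true_and, Set.mem_ofPred_eq] at hij
  obtain ⟨φ, hφ⟩ := hφ i j hij
  by_contra hne
  have hlt := hφ k l fun hkl => hne (by rw [hkl.1, hkl.2])
  exact hlt.ne (congrArg φ heq)

theorem cross_swap (u w : Fin 2 → ℝ) : cross w u = -cross u w := by
  unfold cross
  ring

/-- Reordering the vertices of a triangle makes it positively oriented. -/
theorem exists_pos_orientation {α : Fin 3 → Fin 2 → ℝ}
    (hα : cross (α 1 - α 0) (α 2 - α 0) ≠ 0) :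
    ∃ α' : Fin 3 → Fin 2 → ℝ, Set.range α' = Set.range α ∧
      0 < cross (α' 1 - α' 0) (α' 2 - α' 0) ∧
      ∀ i, ∃ j, edge α' i = edge α j ∨ edge α' i = -edge α j := by
  rcases hα.lt_or_gt with h | h
  · refine ⟨α ∘ Equiv.swap 1 2, (Equiv.swap 1 2).surjective.range_comp α, ?_, fun i => ?_⟩
    · have e : cross ((α ∘ Equiv.swap 1 2) 1 - (α ∘ Equiv.swap 1 2) 0)
          ((α ∘ Equiv.swap 1 2) 2 - (α ∘ Equiv.swap 1 2) 0) =
          cross (α 2 - α 0) (α 1 - α 0) := rfl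
      rw [e, cross_swap]
      linarith
    · fin_cases i
      · exact ⟨2, Or.inr (show α 2 - α 0 = -(α 0 - α 2) by abel)⟩
      · exact ⟨1, Or.inr (show α 1 - α 2 = -(α 2 - α 1) by abel)⟩
      · exact ⟨0, Or.inr (show α 0 - α 1 = -(α 1 - α 0) by abel)⟩
  · exact ⟨α, rfl, h, fun i => ⟨i, Or.inl rfl⟩⟩

theorem isPolygon_six {α β : Fin 3 → Fin 2 → ℝ}
    (hα : cross (α 1 - α 0) (α 2 - α 0) ≠ 0) (hβ : cross (β 1 - β 0) (β 2 - β 0) ≠ 0)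
    (h : ∀ i j, cross (edge α i) (edge β j) ≠ 0) :
    IsPolygon 6 (convexHull ℝ (Set.range α + Set.range β)) := by
  obtain ⟨α', hα₁, hα₂, hα₃⟩ := exists_pos_orientation hα
  obtain ⟨β', hβ₁, hβ₂, hβ₃⟩ := exists_pos_orientation hβ
  rw [← hα₁, ← hβ₁]
  refine isPolygon_six_of_pos hα₂ hβ₂ fun i j => ?_
  obtain ⟨i', hi⟩ := hα₃ i
  obtain ⟨j', hj⟩ := hβ₃ j
  have := h i' j'
  have e1 : ∀ u w : Fin 2 → ℝ, cross (-u) w = -cross u w := fun u w => by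
    simp only [cross, Pi.neg_apply]
    ring
  have e2 : ∀ u w : Fin 2 → ℝ, cross u (-w) = -cross u w := fun u w => by
    simp only [cross, Pi.neg_apply]
    ring
  rcases hi with hi | hi <;> rcases hj with hj | hj <;> rw [hi, hj] <;> simpa [e1, e2] using this

/-! ### Minkowski sums that are triangles -/

theorem cross_ne_zero_of_convexIndependent {v : Fin 3 → Fin 2 → ℝ}
    (hv : ConvexIndependent ℝ v) : cross (v 1 - v 0) (v 2 - v 0) ≠ 0 := by
  intro h0
  have hnot : ∀ i j k : Fin 3, i ≠ j → i ≠ k → v i ∉ segment ℝ (v j) (v k) := by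
    intro i j k hij hik hi
    have := hv {j, k} i (by rwa [Set.image_pair, convexHull_pair])
    simp only [Set.mem_insert_iff, Set.mem_singleton_iff] at this
    tauto
  obtain ⟨k, hk⟩ := exists_eq_smul_of_cross_eq_zero
    (sub_ne_zero.2 (hv.injective.ne (by decide : (1 : Fin 3) ≠ 0))) h0
  have hk' : v 2 = v 0 + k • (v 1 - v 0) := by rw [← hk]; abel
  rcases lt_or_ge k 0 with hk0 | hk0
  · -- `v 0` lies between `v 1` and `v 2`
    refine hnot 0 1 2 (by decide) (by decide) ⟨-k / (1 - k), 1 / (1 - k),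
      div_nonneg (by linarith) (by linarith), div_nonneg zero_le_one (by linarith), ?_, ?_⟩
    · have : 1 - k ≠ 0 := by linarith
      field_simp
      ring
    · have : 1 - k ≠ 0 := by linarith
      rw [hk']
      ext i
      simp only [Pi.add_apply, Pi.smul_apply, Pi.sub_apply, smul_eq_mul]
      field_simp
      ring
  · rcases le_or_gt k 1 with hk1 | hk1
    · refine hnot 2 0 1 (by decide) (by decide) ⟨1 - k, k, by linarith, hk0, by ring, ?_⟩
      rw [hk']
      module
    · refine hnot 1 0 2 (by decide) (by decide) ⟨(k - 1) / k, 1 / k,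
        div_nonneg (by linarith) hk0, div_nonneg zero_le_one hk0, ?_, ?_⟩
      · have : k ≠ 0 := by linarith
        field_simp
        ring
      · have : k ≠ 0 := by linarith
        rw [hk']
        ext i
        simp only [Pi.add_apply, Pi.smul_apply, Pi.sub_apply, smul_eq_mul]
        field_simp
        ring

theorem eq_zero_of_cross_eq_zero {u w x : Fin 2 → ℝ} (h : cross u w ≠ 0) (hu : cross u x = 0)
    (hw : cross w x = 0) : x = 0 := by
  unfold cross at h hu hw
  ext i
  fin_cases i
  · exact (mul_eq_zero.1 (by linear_combination w 0 * hu - u 0 * hw :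
      (u 0 * w 1 - u 1 * w 0) * x 0 = 0)).resolve_left h
  · exact (mul_eq_zero.1 (by linear_combination w 1 * hu - u 1 * hw :
      (u 0 * w 1 - u 1 * w 0) * x 1 = 0)).resolve_left h

/-- If a Minkowski sum of two convex hulls of triples is a triangle, each triple consists of the
vertices of a homothetic triangle: the linear forms defining the sides of the sum are minimal
along the sides of each summand. -/
theorem exists_homothety_of_convexHull_eq {v α β : Fin 3 → Fin 2 → ℝ}
    (hv : ConvexIndependent ℝ v) (hα : Function.Injective α)
    (h : convexHull ℝ (Set.range α + Set.range β) = convexHull ℝ (Set.range v)) :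
    ∃ (σ : Equiv.Perm (Fin 3)) (k : ℝ), k ≠ 0 ∧
      ∀ m, α (σ m) - α (σ 0) = k • (v m - v 0) := by
  have hD := cross_ne_zero_of_convexIndependent hv
  set D := cross (v 1 - v 0) (v 2 - v 0) with hDdef
  -- `ψ l` is constant on the side opposite to `v l` and larger at `v l`
  let ψ : Fin 3 → (Fin 2 → ℝ) →ₗ[ℝ] ℝ := fun l => D⁻¹ • crossₗ (edge v (l + 1))
  have hψ : ∀ l x, ψ l x = D⁻¹ * cross (edge v (l + 1)) x := fun l x => rfl
  have hψv : ∀ l m, m ≠ l → ∀ k, ψ l (v m) ≤ ψ l (v k) := by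
    intro l
    have e1 : ψ l (v l) = ψ l (v (l + 1)) + 1 := by
      rw [hψ, hψ, ← sub_eq_iff_eq_add', ← mul_sub, ← crossₗ_apply, ← crossₗ_apply, ← map_sub,
        crossₗ_apply, ← neg_sub, ← edge, ← inv_mul_cancel₀ hD]
      congr 1
      rw [hDdef, ← cross_edge_edge v l]
      simp only [cross, Pi.neg_apply]
      ring
    have e2 : ψ l (v (l + 2)) = ψ l (v (l + 1)) := by
      have : l + 1 + 1 = l + 2 := add_assoc l 1 1
      rw [hψ, hψ, edge, this]
      simp only [cross, Pi.sub_apply]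
      ring
    intro m hm k
    have e3 : ψ l (v m) = ψ l (v (l + 1)) := by
      rcases eq_or_eq_add_one_or_eq_add_two l m with rfl | rfl | rfl
      · exact absurd rfl hm
      · rfl
      · exact e2
    rw [e3]
    rcases eq_or_eq_add_one_or_eq_add_two l k with rfl | rfl | rfl <;> linarith
  have hle : ∀ l m, m ≠ l → ∀ i j, ψ l (v m) ≤ ψ l (α i + β j) := by
    intro l m hm i j
    have hmem : α i + β j ∈ convexHull ℝ (Set.range v) := h ▸ subset_convexHull ℝ _
      (Set.add_mem_add (Set.mem_range_self i) (Set.mem_range_self j))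
    have hconv : Convex ℝ {y | ψ l (v m) ≤ ψ l y} := convex_halfSpace_ge (ψ l).isLinear _
    have hsub : Set.range v ⊆ {y | ψ l (v m) ≤ ψ l y} := by
      rintro _ ⟨k, rfl⟩
      exact hψv l m hm k
    exact convexHull_min hsub hconv hmem
  have hvert : ∀ m, ∃ i j, v m = α i + β j := by
    intro m
    have hm : v m ∈ (convexHull ℝ (Set.range α + Set.range β)).extremePoints ℝ := by
      rw [h, extremePoints_convexHull_range hv]
      exact Set.mem_range_self m
    obtain ⟨_, ⟨i, rfl⟩, _, ⟨j, rfl⟩, hij⟩ := extremePoints_convexHull_subset hm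
    exact ⟨i, j, hij.symm⟩
  choose s t hst using hvert
  have hmin : ∀ l m, m ≠ l → ∀ i, ψ l (α (s m)) ≤ ψ l (α i) := by
    intro l m hm i
    have := hle l m hm i (t m)
    rw [hst m, map_add, map_add] at this
    linarith
  have hzero : ∀ x, ψ 0 x = 0 → ψ 2 x = 0 → x = 0 := by
    intro x h0 h2
    have e : cross (edge v 0) (edge v 1) ≠ 0 := by
      have := cross_edge_edge v 0
      rw [zero_add] at this
      rwa [this]
    refine eq_zero_of_cross_eq_zero e ?_ ?_
    · exact (mul_eq_zero.1 h2).resolve_left (inv_ne_zero hD)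
    · exact (mul_eq_zero.1 h0).resolve_left (inv_ne_zero hD)
  have hsumψ : ∀ x, ψ 0 x + ψ 1 x + ψ 2 x = 0 := by
    intro x
    have := edge_sum v
    have e0 := congrFun this 0
    have e1 := congrFun this 1
    simp only [Pi.add_apply, Pi.zero_apply] at e0 e1
    have f0 : ψ 0 x = D⁻¹ * cross (edge v 1) x := rfl
    have f1 : ψ 1 x = D⁻¹ * cross (edge v 2) x := rfl
    have f2 : ψ 2 x = D⁻¹ * cross (edge v 0) x := rfl
    rw [f0, f1, f2]
    unfold cross
    linear_combination D⁻¹ * (x 1 * e0 - x 0 * e1)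
  have hs : Function.Injective s := by
    intro m m' hmm
    by_contra hne
    have hall : ∀ l i, ψ l (α (s m)) ≤ ψ l (α i) := by
      intro l i
      by_cases hl : m = l
      · rw [hmm]
        exact hmin l m' (fun h => hne (hl.trans h.symm)) i
      · exact hmin l m hl i
    have heq : ∀ i, α i = α (s m) := by
      intro i
      have a0 := hall 0 i
      have a1 := hall 1 i
      have a2 := hall 2 i
      have b1 := hsumψ (α i)
      have b2 := hsumψ (α (s m))
      refine sub_eq_zero.1 (hzero _ ?_ ?_) <;> rw [map_sub] <;> linarith
    have := hα (heq (s m + 1))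
    simp at this
  have hside : ∀ l m m', m ≠ l → m' ≠ l → cross (edge v (l + 1)) (α (s m) - α (s m')) = 0 := by
    intro l m m' hm hm'
    have h1 := le_antisymm (hmin l m hm (s m')) (hmin l m' hm' (s m))
    have h2 : ψ l (α (s m) - α (s m')) = 0 := by rw [map_sub, h1, sub_self]
    exact (mul_eq_zero.1 h2).resolve_left (inv_ne_zero hD)
  have hedge : ∀ i, edge v i ≠ 0 := by
    intro i
    rw [edge, sub_ne_zero]
    exact hv.injective.ne (by simp)
  obtain ⟨k, hk⟩ := exists_eq_smul_of_cross_eq_zero (hedge 0)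
    (hside 2 1 0 (by decide) (by decide))
  obtain ⟨k', hk'⟩ := exists_eq_smul_of_cross_eq_zero (hedge 2)
    (hside 1 2 0 (by decide) (by decide))
  have hkk : k' = -k := by
    have h1 := hside 0 2 1 (by decide) (by decide)
    have e : α (s 2) - α (s 1) = k' • edge v 2 - k • edge v 0 := by
      rw [← hk, ← hk']
      abel
    rw [e] at h1
    have h2 : D * (k' + k) = 0 := by
      rw [← h1, hDdef]
      simp [cross, edge]
      ring
    linarith [(mul_eq_zero.1 h2).resolve_left hD]
  refine ⟨Equiv.ofBijective s (Finite.injective_iff_bijective.1 hs), k, ?_, fun m => ?_⟩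
  · rintro rfl
    rw [zero_smul, sub_eq_zero] at hk
    exact absurd (hs (hα hk)) (by decide)
  · simp only [Equiv.ofBijective_apply]
    fin_cases m
    · simp
    · exact hk
    · refine hk'.trans ?_
      rw [hkk, edge]
      change -k • (v 0 - v 2) = k • (v 2 - v 0)
      module

/-! ### Bounds for the number of isolated roots -/

theorem exists_eq_smul_sub_of_cross_eq_zero {α : Fin 3 → Fin 2 → ℝ} (hα : Function.Injective α)
    (h : cross (α 1 - α 0) (α 2 - α 0) = 0) : ∃ k : ℝ, α 2 - α 0 = k • (α 1 - α 0) :=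
  exists_eq_smul_of_cross_eq_zero (sub_ne_zero.2 (hα.ne (by decide))) h

theorem encard_isolatedPoints_le_four_or_isPolygon_six {α β : Fin 3 → Fin 2 → ℝ}
    {c d : Fin 3 → ℝ} (hα : Function.Injective α) (hβ : Function.Injective β)
    (hc : ∀ j, c j ≠ 0) (hd : ∀ j, d j ≠ 0) :
    (isolatedPoints (rootSet α c β d)).encard ≤ 4 ∨
      IsPolygon 6 (convexHull ℝ (Set.range α + Set.range β)) := by
  by_cases hα0 : cross (α 1 - α 0) (α 2 - α 0) = 0
  · obtain ⟨k, hk⟩ := exists_eq_smul_sub_of_cross_eq_zero hα hα0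
    left
    by_cases hβ0 : cross (β 1 - β 0) (β 2 - β 0) = 0
    · obtain ⟨l, hl⟩ := exists_eq_smul_sub_of_cross_eq_zero hβ hβ0
      by_cases hαβ : cross (α 1 - α 0) (β 1 - β 0) = 0
      · have hne : α 1 - α 0 ≠ 0 := sub_ne_zero.2 (hα.ne (by decide))
        obtain ⟨r, hr⟩ := exists_eq_smul_of_cross_eq_zero hne hαβ
        rw [isolatedPoints_eq_empty_of_parallel hne]
        · simp
        · intro j
          fin_cases j
          · exact ⟨0, by simp⟩
          · exact ⟨1, by simp⟩
          · exact ⟨k, hk⟩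
        · intro j
          fin_cases j
          · exact ⟨0, by simp⟩
          · exact ⟨r, hr⟩
          · exact ⟨l * r, by rw [mul_smul, ← hr]; exact hl⟩
      · exact encard_isolatedPoints_le_four_of_collinear_of_collinear hαβ hα hβ (hc 2) (hd 2) hk hl
    · rw [rootSet_swap]
      exact encard_isolatedPoints_le_four_of_collinear hβ0 (hd 2) hk
  · by_cases hβ0 : cross (β 1 - β 0) (β 2 - β 0) = 0
    · obtain ⟨l, hl⟩ := exists_eq_smul_sub_of_cross_eq_zero hβ hβ0
      exact Or.inl (encard_isolatedPoints_le_four_of_collinear hα0 (hc 2) hl)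
    · by_cases h : ∀ i j, cross (edge α i) (edge β j) ≠ 0
      · exact Or.inr (isPolygon_six hα0 hβ0 h)
      · push Not at h
        obtain ⟨i, j, hij⟩ := h
        have hne : edge α i ≠ 0 := sub_ne_zero.2 (hα.ne (by simp))
        obtain ⟨k, hk⟩ := exists_eq_smul_of_cross_eq_zero hne hij
        left
        -- relabel so that the parallel edges come first
        rw [← rootSet_comp_perm α c β d (Equiv.addLeft i) (Equiv.addLeft j)]
        refine encard_isolatedPoints_le_four_of_parallel (k := k) ?_ (hc _) ?_
        · have e : cross (α (i + 1) - α (i + 0)) (α (i + 2) - α (i + 0)) =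
              cross (α 1 - α 0) (α 2 - α 0) := by
            fin_cases i <;> simp [cross] <;> ring
          rw [← e] at hα0
          exact hα0
        · simpa [edge] using hk

theorem encard_isolatedPoints_le_two_of_isPolygon_three {α β : Fin 3 → Fin 2 → ℝ}
    {c d : Fin 3 → ℝ} (hα : Function.Injective α) (hβ : Function.Injective β)
    (hc : ∀ j, c j ≠ 0) (h : IsPolygon 3 (convexHull ℝ (Set.range α + Set.range β))) :
    (isolatedPoints (rootSet α c β d)).encard ≤ 2 := by
  obtain ⟨-, v, hv, hP⟩ := h
  obtain ⟨σ, k, hk, hσ⟩ := exists_homothety_of_convexHull_eq hv hα hP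
  obtain ⟨τ, l, -, hτ⟩ := exists_homothety_of_convexHull_eq hv hβ (by rw [add_comm]; exact hP)
  rw [← rootSet_comp_perm α c β d σ τ]
  have key : ∀ m, β (τ m) - β (τ 0) = (l / k) • (α (σ m) - α (σ 0)) := by
    intro m
    rw [hσ, hτ, smul_smul, div_mul_cancel₀ l hk]
  refine encard_isolatedPoints_le_two_of_homothetic (k := l / k) ?_ (hc _) (key 1) (key 2)
  simp only [Function.comp, hσ]
  have e : cross (k • (v 1 - v 0)) (k • (v 2 - v 0)) = k ^ 2 * cross (v 1 - v 0) (v 2 - v 0) := by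
    simp only [cross, Pi.smul_apply, smul_eq_mul]
    ring
  rw [e]
  exact mul_ne_zero (pow_ne_zero _ hk) (cross_ne_zero_of_convexIndependent hv)

theorem isolatedPoints_eq_empty_of_isLineSegment {α β : Fin 3 → Fin 2 → ℝ} {c d : Fin 3 → ℝ}
    (h : IsLineSegment (convexHull ℝ (Set.range α + Set.range β))) :
    isolatedPoints (rootSet α c β d) = ∅ := by
  obtain ⟨p, q, hpq, hP⟩ := h
  have hmem : ∀ i j, ∃ r : ℝ, α i + β j = p + r • (q - p) := by
    intro i j
    have : α i + β j ∈ segment ℝ p q := hP ▸ subset_convexHull ℝ _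
      (Set.add_mem_add (Set.mem_range_self i) (Set.mem_range_self j))
    rw [segment_eq_image'] at this
    obtain ⟨r, -, hr⟩ := this
    exact ⟨r, hr.symm⟩
  choose r hr using hmem
  refine isolatedPoints_eq_empty_of_parallel (sub_ne_zero.2 hpq.symm)
    (fun j => ⟨r j 0 - r 0 0, ?_⟩) (fun j => ⟨r 0 j - r 0 0, ?_⟩)
  · rw [← add_sub_add_right_eq_sub _ _ (β 0), hr, hr]
    module
  · rw [← add_sub_add_left_eq_sub _ _ (α 0), hr, hr]
    module

/-! ### Trinomials as indexed sums -/

theorem Fewnomial.exists_value_eq_sum {f : Fewnomial 2} (hf : f.supp.card = 3) :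
    ∃ (α : Fin 3 → Fin 2 → ℝ) (c : Fin 3 → ℝ), Function.Injective α ∧ (∀ j, c j ≠ 0) ∧
      f.newt = convexHull ℝ (Set.range α) ∧ ∀ x, f.value x = ∑ j, c j * mon (α j) x := by
  let e : Fin 3 ≃ f.supp := (Finset.equivFinOfCardEq hf).symm
  refine ⟨fun j => e j, fun j => f.coeff (e j), Subtype.val_injective.comp e.injective,
    fun j => Finsupp.mem_support_iff.1 (e j).2, ?_, fun x => ?_⟩
  · rw [Fewnomial.newt]
    congr 1
    ext a
    exact ⟨fun ha => ⟨e.symm ⟨a, ha⟩, by simp⟩, by rintro ⟨j, rfl⟩; exact (e j).2⟩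
  · rw [Fewnomial.value, ← Finset.sum_coe_sort]
    exact (Equiv.sum_comp e fun a : f.supp => f.coeff a * mon a x).symm

theorem Fewnomial.exists_of_exponents {α : Fin 3 → Fin 2 → ℝ} {c : Fin 3 → ℝ}
    (hα : Function.Injective α) (hc : ∀ j, c j ≠ 0) :
    ∃ f : Fewnomial 2, f.supp.card = 3 ∧ f.newt = convexHull ℝ (Set.range α) ∧
      ∀ x, f.value x = ∑ j, c j * mon (α j) x := by
  let f : Fewnomial 2 :=
    .ofCoeff (Finsupp.embDomain ⟨α, hα⟩ (Finsupp.equivFunOnFinite.symm c))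
  have hcoeff : ∀ j, f.coeff (α j) = c j := fun j =>
    Finsupp.embDomain_apply_self ⟨α, hα⟩ (Finsupp.equivFunOnFinite.symm c) j
  have hsupp : f.supp = Finset.univ.map ⟨α, hα⟩ := by
    have : (Finsupp.equivFunOnFinite.symm c).support = Finset.univ := by
      ext j
      simp [hc j]
    rw [← this]
    exact Finsupp.support_embDomain _ _
  refine ⟨f, ?_, ?_, fun x => ?_⟩
  · simp [hsupp]
  · simp [Fewnomial.newt, hsupp]
  · rw [Fewnomial.value, hsupp, Finset.sum_map]
    exact Finset.sum_congr rfl fun j _ => congrArg (· * mon (α j) x) (hcoeff j)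

theorem FewnomialSystem.exists_isolatedRoots_eq {F : FewnomialSystem 2 2}
    (hF : F.IsOfType ![3, 3]) :
    ∃ (α β : Fin 3 → Fin 2 → ℝ) (c d : Fin 3 → ℝ), Function.Injective α ∧
      Function.Injective β ∧ (∀ j, c j ≠ 0) ∧ (∀ j, d j ≠ 0) ∧
      F.newtSum = convexHull ℝ (Set.range α + Set.range β) ∧
      F.isolatedRoots = isolatedPoints (rootSet α c β d) := by
  obtain ⟨α, c, hα, hc, hn₁, hv₁⟩ := Fewnomial.exists_value_eq_sum (hF 0)
  obtain ⟨β, d, hβ, hd, hn₂, hv₂⟩ := Fewnomial.exists_value_eq_sum (hF 1)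
  refine ⟨α, β, c, d, hα, hβ, hc, hd, ?_, ?_⟩
  · rw [FewnomialSystem.newtSum, Fin.sum_univ_two, hn₁, hn₂, convexHull_add]
  · have : F.positiveRoots = rootSet α c β d := by
      ext x
      simp only [FewnomialSystem.positiveRoots, rootSet, Set.mem_ofPred_eq, Fin.forall_fin_two,
        hv₁, hv₂]
    rw [← this]
    rfl

theorem FewnomialSystem.exists_of_exponents {α β : Fin 3 → Fin 2 → ℝ} {c d : Fin 3 → ℝ}
    (hα : Function.Injective α) (hβ : Function.Injective β) (hc : ∀ j, c j ≠ 0)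
    (hd : ∀ j, d j ≠ 0) :
    ∃ F : FewnomialSystem 2 2, F.IsOfType ![3, 3] ∧
      F.newtSum = convexHull ℝ (Set.range α + Set.range β) ∧
      F.isolatedRoots = isolatedPoints (rootSet α c β d) := by
  obtain ⟨f, hf, hn₁, hv₁⟩ := Fewnomial.exists_of_exponents hα hc
  obtain ⟨g, hg, hn₂, hv₂⟩ := Fewnomial.exists_of_exponents hβ hd
  refine ⟨![f, g], ?_, ?_, ?_⟩
  · intro i
    fin_cases i
    · exact hf
    · exact hg
  · rw [FewnomialSystem.newtSum, Fin.sum_univ_two, convexHull_add, ← hn₁, ← hn₂]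
    rfl
  · have : FewnomialSystem.positiveRoots ![f, g] = rootSet α c β d := by
      ext x
      simp only [FewnomialSystem.positiveRoots, rootSet, Set.mem_ofPred_eq, Fin.forall_fin_two,
        Matrix.cons_val_zero, Matrix.cons_val_one, hv₁, hv₂]
    rw [← this]
    rfl

theorem encard_isolatedRoots_le_four {l : ℕ} (hl : l ≠ 6) {F : FewnomialSystem 2 2}
    (hF : F.IsOfType ![3, 3]) (hP : IsPolygon l F.newtSum) : F.isolatedRoots.encard ≤ 4 := by
  obtain ⟨α, β, c, d, hα, hβ, hc, hd, hn, hi⟩ := FewnomialSystem.exists_isolatedRoots_eq hF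
  rw [hi]
  refine (encard_isolatedPoints_le_four_or_isPolygon_six hα hβ hc hd).resolve_right fun h => hl ?_
  rw [← hP.ncard_extremePoints, hn, h.ncard_extremePoints]

/-! ### Extremal examples -/

theorem encard_isolatedPoints_of_eq_range {X : Type*} [MetricSpace X] {l : ℕ} {S : Set X}
    {r : Fin l → X} (hr : Function.Injective r) (hS : S = Set.range r) :
    (isolatedPoints S).encard = l := by
  rw [isolatedPoints_of_finite (hS ▸ Set.finite_range r), hS,
    ← Set.image_univ, hr.encard_image, Set.encard_univ, ENat.card_eq_coe_fintype_card,
    Fintype.card_fin]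

/-- A criterion for a Minkowski sum to have given vertices `v`: these occur as sums, each is the
unique minimum on `v` of some linear form `cross (u m)`, and every sum is an explicit convex
combination of them. -/
theorem isPolygon_of_weights {l : ℕ} (hl : 3 ≤ l) {α β : Fin 3 → Fin 2 → ℝ}
    (v : Fin l → Fin 2 → ℝ) (u : Fin l → Fin 2 → ℝ) (w : Fin 3 → Fin 3 → Fin l → ℝ)
    (hv : ∀ m, ∃ i j, v m = α i + β j) (hu : ∀ m k, k ≠ m → cross (u m) (v m) < cross (u m) (v k))
    (hw : ∀ i j m, 0 ≤ w i j m) (hw₁ : ∀ i j, ∑ m, w i j m = 1)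
    (hw₂ : ∀ i j, α i + β j = ∑ m, w i j m • v m) :
    IsPolygon l (convexHull ℝ (Set.range α + Set.range β)) := by
  refine ⟨hl, v, convexIndependent_of_forall_exists_lt fun m => ⟨crossₗ (u m), hu m⟩, ?_⟩
  refine (convexHull_min ?_ (convex_convexHull ℝ _)).antisymm (convexHull_mono ?_)
  · rintro _ ⟨_, ⟨i, rfl⟩, _, ⟨j, rfl⟩, rfl⟩
    have := (convex_convexHull ℝ (Set.range v)).sum_mem (t := Finset.univ) (w := w i j) (z := v)
      (fun m _ => hw i j m) (hw₁ i j) fun m _ => subset_convexHull ℝ _ (Set.mem_range_self m)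
    rw [← hw₂ i j] at this
    exact this
  · rintro _ ⟨m, rfl⟩
    obtain ⟨i, j, hij⟩ := hv m
    rw [hij]
    exact Set.add_mem_add (Set.mem_range_self i) (Set.mem_range_self j)

theorem rootSet_eq_of_iff {α β : Fin 3 → Fin 2 → ℝ} {c d : Fin 3 → ℝ} {l : ℕ}
    {r : Fin l → Fin 2 → ℝ}
    (h : ∀ x y : ℝ, (0 < x ∧ 0 < y ∧ ∑ j, c j * (x ^ α j 0 * y ^ α j 1) = 0 ∧
      ∑ j, d j * (x ^ β j 0 * y ^ β j 1) = 0) ↔ ∃ m, r m 0 = x ∧ r m 1 = y) :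
    rootSet α c β d = Set.range r := by
  ext z
  have := h (z 0) (z 1)
  simp only [rootSet, Set.mem_ofPred_eq, Fin.forall_fin_two, mon, Fin.prod_univ_two, and_assoc,
    this, Set.mem_range, funext_iff]

/-- The exponent vectors `0`, `(a₀, a₁)`, `(b₀, b₁)`. -/
def exponents (a₀ a₁ b₀ b₁ : ℝ) : Fin 3 → Fin 2 → ℝ := ![![0, 0], ![a₀, a₁], ![b₀, b₁]]

theorem isLineSegment_example :
    IsLineSegment (convexHull ℝ (Set.range (exponents 1 0 2 0) +
      Set.range (exponents 1 0 2 0))) := by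
  refine ⟨![0, 0], ![4, 0], fun h => by simpa using congrFun h 0, ?_⟩
  refine (convexHull_min ?_ (convex_segment _ _)).antisymm ?_
  · rintro _ ⟨_, ⟨i, rfl⟩, _, ⟨j, rfl⟩, rfl⟩
    rw [segment_eq_image']
    refine ⟨(exponents 1 0 2 0 i 0 + exponents 1 0 2 0 j 0) / 4, ?_, ?_⟩
    · fin_cases i <;> fin_cases j <;> simp [exponents] <;> norm_num
    · ext k
      fin_cases i <;> fin_cases j <;> fin_cases k <;> simp [exponents]
  · rw [← convexHull_pair]
    refine convexHull_mono ?_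
    rintro _ (rfl | rfl)
    · exact ⟨_, ⟨0, rfl⟩, _, ⟨0, rfl⟩, by ext k; fin_cases k <;> simp [exponents]⟩
    · exact ⟨_, ⟨2, rfl⟩, _, ⟨2, rfl⟩, by ext k; fin_cases k <;> simp [exponents]; norm_num⟩

/-- The equation `1 + x + x² = 0`, taken twice, has no positive root. -/
theorem rootSet_line_example :
    rootSet (exponents 1 0 2 0) ![1, 1, 1] (exponents 1 0 2 0) ![1, 1, 1] = ∅ := by
  refine Set.eq_empty_of_forall_notMem ?_
  rintro x ⟨hx, h, -⟩
  have h0 := mon_pos (exponents 1 0 2 0 0) hx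
  have h1 := mon_pos (exponents 1 0 2 0 1) hx
  have h2 := mon_pos (exponents 1 0 2 0 2) hx
  simp only [Fin.sum_univ_three, Matrix.cons_val, one_mul] at h
  linarith

theorem isPolygon_three_example :
    IsPolygon 3 (convexHull ℝ (Set.range (exponents 1 0 0 1) +
      Set.range (exponents 2 0 0 2))) := by
  refine isPolygon_of_weights le_rfl ![![0, 0], ![3, 0], ![0, 3]] ![![1, -1], ![0, 1], ![-1, 0]]
    (fun i j m => ((if i = m then 1 else 0) + 2 * (if j = m then 1 else 0)) / 3)
    (fun m => ⟨m, m, ?_⟩) ?_ ?_ ?_ ?_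
  · ext k
    fin_cases m <;> fin_cases k <;> simp [exponents] <;> norm_num
  · intro m k hk
    fin_cases m <;> fin_cases k <;> first | exact absurd rfl hk | norm_num [cross]
  · intro i j m
    positivity
  · intro i j
    fin_cases i <;> fin_cases j <;> simp [Fin.sum_univ_three] <;> norm_num
  · intro i j
    ext k
    fin_cases i <;> fin_cases j <;> fin_cases k <;> simp [Fin.sum_univ_three, exponents]

/-- The pair `x + y = 5`, `x² + y² = 17`. -/
theorem rootSet_triangle_example :
    rootSet (exponents 1 0 0 1) ![-5, 1, 1] (exponents 2 0 0 2) ![-17, 1, 1] =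
      Set.range ![![1, 4], ![4, 1]] := by
  refine rootSet_eq_of_iff fun x y => ?_
  simp [Fin.sum_univ_three, Fin.exists_fin_two, exponents]
  constructor
  · rintro ⟨-, -, h1, h2⟩
    have hy : y = 5 - x := by linarith
    subst hy
    have h3 : (x - 1) * (x - 4) = 0 := by linear_combination h2 / 2
    rcases mul_eq_zero.1 h3 with h | h
    · left; constructor <;> linarith
    · right; constructor <;> linarith
  · rintro (⟨rfl, rfl⟩ | ⟨rfl, rfl⟩) <;> norm_num

theorem isPolygon_four_example :
    IsPolygon 4 (convexHull ℝ (Set.range (exponents 1 0 2 0) +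
      Set.range (exponents 0 1 0 2))) := by
  refine isPolygon_of_weights (by norm_num) ![![0, 0], ![2, 0], ![0, 2], ![2, 2]]
    ![![1, -1], ![1, 1], ![-1, -1], ![-1, 1]]
    (fun i j => ![(2 - (i : ℕ)) * (2 - (j : ℕ)) / 4, (i : ℕ) * (2 - (j : ℕ)) / 4,
      (2 - (i : ℕ)) * (j : ℕ) / 4, (i : ℕ) * (j : ℕ) / 4]) (fun m => ?_) ?_ ?_ ?_ ?_
  · refine ⟨![0, 2, 0, 2] m, ![0, 0, 2, 2] m, ?_⟩
    ext k
    fin_cases m <;> fin_cases k <;> simp [exponents]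
  · intro m k hk
    fin_cases m <;> fin_cases k <;> first | exact absurd rfl hk | norm_num [cross]
  · intro i j m
    fin_cases i <;> fin_cases j <;> fin_cases m <;> norm_num
  · intro i j
    fin_cases i <;> fin_cases j <;> simp [Fin.sum_univ_four] <;> norm_num
  · intro i j
    ext k
    fin_cases i <;> fin_cases j <;> fin_cases k <;> simp [Fin.sum_univ_four, exponents] <;> norm_num

/-- The pair `x² - 3x + 2 = 0`, `y² - 3y + 2 = 0`. -/
theorem rootSet_quadrilateral_example :
    rootSet (exponents 1 0 2 0) ![2, -3, 1] (exponents 0 1 0 2) ![2, -3, 1] =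
      Set.range ![![1, 1], ![1, 2], ![2, 1], ![2, 2]] := by
  have key : ∀ t : ℝ, 2 + -(3 * t) + t ^ 2 = 0 → t = 1 ∨ t = 2 := by
    intro t ht
    have : (t - 1) * (t - 2) = 0 := by linear_combination ht
    rcases mul_eq_zero.1 this with h | h
    · left; linarith
    · right; linarith
  refine rootSet_eq_of_iff fun x y => ?_
  simp [Fin.sum_univ_three, Fin.exists_fin_succ, exponents]
  constructor
  · rintro ⟨-, -, h1, h2⟩
    rcases key x h1 with rfl | rfl <;> rcases key y h2 with rfl | rfl <;> simp
  · rintro (⟨rfl, rfl⟩ | ⟨rfl, rfl⟩ | ⟨rfl, rfl⟩ | ⟨rfl, rfl⟩) <;> norm_num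

theorem isPolygon_five_example :
    IsPolygon 5 (convexHull ℝ (Set.range (exponents 1 0 0 1) +
      Set.range (exponents 1 1 2 2))) := by
  refine isPolygon_of_weights (by norm_num) ![![0, 0], ![1, 0], ![0, 1], ![3, 2], ![2, 3]]
    ![![1, -1], ![3, 2], ![-2, -3], ![1, 2], ![-2, -1]]
    ![![![1, 0, 0, 0, 0], ![3 / 5, 0, 0, 1 / 5, 1 / 5], ![1 / 5, 0, 0, 2 / 5, 2 / 5]],
      ![![0, 1, 0, 0, 0], ![0, 1 / 2, 0, 1 / 2, 0], ![0, 0, 0, 1, 0]],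
      ![![0, 0, 1, 0, 0], ![0, 0, 1 / 2, 0, 1 / 2], ![0, 0, 0, 0, 1]]] (fun m => ?_) ?_ ?_ ?_ ?_
  · refine ⟨![0, 1, 2, 1, 2] m, ![0, 0, 0, 2, 2] m, ?_⟩
    ext k
    fin_cases m <;> fin_cases k <;> simp [exponents] <;> norm_num
  · intro m k hk
    fin_cases m <;> fin_cases k <;> first | exact absurd rfl hk | norm_num [cross]
  · intro i j m
    fin_cases i <;> fin_cases j <;> fin_cases m <;> norm_num
  · intro i j
    fin_cases i <;> fin_cases j <;> simp [Fin.sum_univ_five] <;> norm_num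
  · intro i j
    ext k
    fin_cases i <;> fin_cases j <;> fin_cases k <;> simp [Fin.sum_univ_five, exponents] <;> norm_num

/-- The pair `x + y = 5`, `(xy)² - 10 xy + 24 = 0`: the line meets each of the hyperbolas
`xy = 4` and `xy = 6` twice. -/
theorem rootSet_pentagon_example :
    rootSet (exponents 1 0 0 1) ![-5, 1, 1] (exponents 1 1 2 2) ![24, -10, 1] =
      Set.range ![![1, 4], ![4, 1], ![2, 3], ![3, 2]] := by
  refine rootSet_eq_of_iff fun x y => ?_
  simp [Fin.sum_univ_three, Fin.exists_fin_succ, exponents]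
  constructor
  · rintro ⟨-, -, h1, h2⟩
    have hy : y = 5 - x := by linarith
    subst hy
    have h3 : ((x - 1) * (x - 4)) * ((x - 2) * (x - 3)) = 0 := by linear_combination h2
    rcases mul_eq_zero.1 h3 with h | h <;> rcases mul_eq_zero.1 h with h | h
    · left; constructor <;> linarith
    · right; left; constructor <;> linarith
    · right; right; left; constructor <;> linarith
    · right; right; right; constructor <;> linarith
  · rintro (⟨rfl, rfl⟩ | ⟨rfl, rfl⟩ | ⟨rfl, rfl⟩ | ⟨rfl, rfl⟩) <;> norm_num

theorem exponents_injective {a₀ a₁ b₀ b₁ : ℝ} (ha : a₀ ≠ 0 ∨ a₁ ≠ 0) (hb : b₀ ≠ 0 ∨ b₁ ≠ 0)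
    (hab : a₀ ≠ b₀ ∨ a₁ ≠ b₁) : Function.Injective (exponents a₀ a₁ b₀ b₁) := by
  intro i j h
  have h0 := congrFun h 0
  have h1 := congrFun h 1
  fin_cases i <;> fin_cases j <;> simp [exponents] at h0 h1 ⊢ <;> grind

/-- A pair of trinomials realizes the number of isolated points of its root set. -/
theorem exists_isOfType_of_rootSet {C : Set (Fin 2 → ℝ) → Prop} {N : ℕ∞}
    {α β : Fin 3 → Fin 2 → ℝ} {c d : Fin 3 → ℝ} (hα : Function.Injective α)
    (hβ : Function.Injective β) (hc : ∀ j, c j ≠ 0) (hd : ∀ j, d j ≠ 0)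
    (hC : C (convexHull ℝ (Set.range α + Set.range β)))
    (hN : (isolatedPoints (rootSet α c β d)).encard = N) :
    ∃ F : FewnomialSystem 2 2, F.IsOfType ![3, 3] ∧ C F.newtSum ∧ F.isolatedRoots.encard = N := by
  obtain ⟨F, hF, hn, hi⟩ := FewnomialSystem.exists_of_exponents hα hβ hc hd
  exact ⟨F, hF, hn ▸ hC, hi ▸ hN⟩

/-! ### The maximal numbers of isolated roots -/

theorem mainTheorem6 :
    IsMaxIsolatedRootsOfTrinomialPairs IsLineSegment 0 ∧
    IsMaxIsolatedRootsOfTrinomialPairs (IsPolygon 3) 2 ∧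
    IsMaxIsolatedRootsOfTrinomialPairs (IsPolygon 4) 4 ∧
    IsMaxIsolatedRootsOfTrinomialPairs (IsPolygon 5) 4 ∧
    (∀ F : FewnomialSystem 2 2, F.IsOfType ![3, 3] →
      5 ≤ F.isolatedRoots.encard → IsPolygon 6 F.newtSum) := by
  have hinj : ∀ {l : ℕ} {r : Fin l → Fin 2 → ℝ}, (∀ i j, r i 0 = r j 0 → r i 1 = r j 1 → i = j) →
      Function.Injective r := fun h i j hij => h i j (congrFun hij 0) (congrFun hij 1)
  refine ⟨⟨?_, ?_⟩, ⟨?_, ?_⟩, ⟨?_, ?_⟩, ⟨?_, ?_⟩, ?_⟩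
  · refine exists_isOfType_of_rootSet (exponents_injective (by norm_num) (by norm_num)
      (by norm_num)) (exponents_injective (by norm_num) (by norm_num) (by norm_num))
      (c := ![1, 1, 1]) (d := ![1, 1, 1]) ?_ ?_ isLineSegment_example ?_
    · simp [Fin.forall_fin_succ]
    · simp [Fin.forall_fin_succ]
    · rw [rootSet_line_example, Set.encard_eq_zero]
      exact Set.subset_empty_iff.1 (isolatedPoints_subset _)
  · rintro _ ⟨F, hF, hP, rfl⟩
    obtain ⟨α, β, c, d, -, -, -, -, hn, hi⟩ := FewnomialSystem.exists_isolatedRoots_eq hF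
    rw [hi, isolatedPoints_eq_empty_of_isLineSegment (hn ▸ hP), Set.encard_empty]
  · refine exists_isOfType_of_rootSet (exponents_injective (by norm_num) (by norm_num)
      (by norm_num)) (exponents_injective (by norm_num) (by norm_num) (by norm_num))
      ?_ ?_ isPolygon_three_example
      (encard_isolatedPoints_of_eq_range (hinj ?_) rootSet_triangle_example)
    · simp [Fin.forall_fin_succ]
    · simp [Fin.forall_fin_succ]
    · simp [Fin.forall_fin_succ]
  · rintro _ ⟨F, hF, hP, rfl⟩
    obtain ⟨α, β, c, d, hα, hβ, hc, -, hn, hi⟩ := FewnomialSystem.exists_isolatedRoots_eq hF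
    rw [hi]
    exact encard_isolatedPoints_le_two_of_isPolygon_three hα hβ hc (hn ▸ hP)
  · refine exists_isOfType_of_rootSet (exponents_injective (by norm_num) (by norm_num)
      (by norm_num)) (exponents_injective (by norm_num) (by norm_num) (by norm_num))
      ?_ ?_ isPolygon_four_example
      (encard_isolatedPoints_of_eq_range (hinj ?_) rootSet_quadrilateral_example)
    · simp [Fin.forall_fin_succ]
    · simp [Fin.forall_fin_succ]
    · simp [Fin.forall_fin_succ]
  · rintro _ ⟨F, hF, hP, rfl⟩
    exact encard_isolatedRoots_le_four (by norm_num) hF hP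
  · refine exists_isOfType_of_rootSet (exponents_injective (by norm_num) (by norm_num)
      (by norm_num)) (exponents_injective (by norm_num) (by norm_num) (by norm_num))
      ?_ ?_ isPolygon_five_example
      (encard_isolatedPoints_of_eq_range (hinj ?_) rootSet_pentagon_example)
    · simp [Fin.forall_fin_succ]
    · simp [Fin.forall_fin_succ]
    · simp [Fin.forall_fin_succ]
  · rintro _ ⟨F, hF, hP, rfl⟩
    exact encard_isolatedRoots_le_four (by norm_num) hF hP
  · intro F hF h5
    obtain ⟨α, β, c, d, hα, hβ, hc, hd, hn, hi⟩ := FewnomialSystem.exists_isolatedRoots_eq hF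
    rw [hn]
    refine (encard_isolatedPoints_le_four_or_isPolygon_six hα hβ hc hd).resolve_left fun h4 => ?_
    rw [← hi] at h4
    exact absurd (h5.trans h4) (by norm_num)

end
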